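/- \textbf{Théorème} (Table 7). Let $K$ be a field of characteristic $\neq 2$. An evolution algebra is a finite-dimensional commutative (not necessarily associative) $K$-algebra $N$ having a natural basis, i.e. a basis $e_1,\dots,e_n$ with $e_ie_j=0$ for $i\ne j$. With principal powers $x^1=x$, $x^{k+1}=x^kx$, the algebra $N$ is nil if every $x\in N$ has some $x^{k}=0$, and power-associative if $x^ix^j=x^{i+j}$ for all $x\in N$ and $i,j\ge 1$. It is indecomposable if it is not the direct sum of two nonzero ideals. Put $\mathrm{ann}(N)=\{x\in N: xN=0\}$, and let $D(N)$ be the space of all derivations, i.e. of linear maps $d:N\to N$ with $d(uv)=u\,d(v)+d(u)\,v$. Consider the following algebras, given by the squares of a natural basis $e_1,\dots,e_n$, where in all of them $e_1^2=e_2+e_3$, $e_2^2=e_n$, $e_3^2=-e_n$, $e_n^2=0$: \begin{itemize} \item $N_{4,6}$: $n=4$; \item $N_{5,10}(\alpha)$: $n=5$, $e_4^2=\alpha e_5$, $\alpha\neq0$; \item $N_{5,11}(\alpha)$: $n=5$, $e_4^2=\alpha(e_2+e_3)$, $\alpha\neq0$; \item $N_{5,12}(\alpha,\beta)$: $n=5$,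 $e_4^2=\alpha(e_2+e_3)+\beta e_5$, $\alpha\beta\neq0$; \item $N_{6,19}(\alpha,\beta)$: $n=6$, $e_4^2=\alpha e_6$, $e_5^2=\beta e_6$, $\alpha\beta\ne0$; \item $N_{6,20}(\alpha,\beta)$: $n=6$, $e_4^2=\alpha(e_2+e_3)$, $e_5^2=\beta e_6$, $\alpha\beta\ne0$; \item $N_{6,21}(\alpha,\beta,\gamma)$: $n=6$, $e_4^2=\alpha(e_2+e_3)+\beta e_6$, $e_5^2=\gamma e_6$, $\alpha\beta\gamma\ne0$; \item $N_{6,22}(\alpha,\beta)$: $n=6$, $e_4^2=\alpha(e_2+e_3)$, $e_5^2=\beta(e_2+e_3)$, $\alpha\beta\ne0$; \item $N_{6,23}(\alpha,\beta,\gamma,\delta)$: $n=6$, $e_4^2=\alpha(e_2+e_3)+\beta e_6$, $e_5^2=\gamma(e_2+e_3)+\delta e_6$, $\alpha\delta-\beta\gamma\ne0$, $\alpha\gamma\neq0$, $\beta\delta\ne0$; \item $N_{6,24}(\alpha,\beta,\gamma)$: $n=6$, $e_4^2=\alpha(e_2+e_3)+\beta e_6$, $e_5^2=\gamma(e_2+e_3)$,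 $\alpha\beta\gamma\ne0$. \end{itemize} (1) Every indecomposable, power-associative, non-associative evolution nilalgebra $N$ with $\dim N\le 6$ and $\dim\mathrm{ann}(N)=1$ has a natural basis with one of these multiplication tables, for some values of the parameters. (2) For each of these algebras, a linear map $d$ is a derivation if and only if there are scalars $d_{ji}\in K$ such that $d$ is given on the natural basis as follows; moreover $D(N)$ is, as a vector space, isomorphic to the space stated. \begin{itemize} \item $N_{4,6}$: $d(e_1)=d_{11}e_1+d_{41}e_4$, $d(e_2)=d_{22}e_2+(2d_{11}-d_{22})e_3+d_{42}e_4$, $d(e_3)=(2d_{11}-d_{22})e_2+d_{22}e_3-d_{42}e_4$, $d(e_4)=2d_{22}e_4$; $D(N)\simeq K^2\times K^2$. \item $N_{5,10}(\alpha)$: $d(e_1)=d_{11}e_1+d_{51}e_5$, $d(e_2)=d_{22}e_2+(2d_{11}-d_{22})e_3+d_{42}e_4+d_{52}e_5$, $d(e_3)=(2d_{11}-d_{22})e_2+d_{22}e_3-d_{42}e_4-d_{52}e_5$, $d(e_4)=-\alpha d_{42}e_2-\alpha d_{42}e_3+d_{22}e_4+d_{54}e_5$, $d(e_5)=2d_{22}e_5$;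 $D(N)\simeq K^3\times K^3$. \item $N_{5,11}(\alpha)$: $d(e_1)=d_{11}e_1+d_{41}e_4+d_{51}e_5$, $d(e_2)=d_{22}e_2+(2d_{11}-d_{22})e_3+d_{52}e_5$, $d(e_3)=(2d_{11}-d_{22})e_2+d_{22}e_3-d_{52}e_5$, $d(e_4)=-\alpha d_{41}e_1+d_{11}e_4+d_{54}e_5$, $d(e_5)=2d_{22}e_5$; $D(N)\simeq K^3\times K^3$. \item $N_{5,12}(\alpha,\beta)$: $d(e_1)=d_{11}e_1+d_{51}e_5$, $d(e_2)=d_{11}e_2+d_{11}e_3+d_{52}e_5$, $d(e_3)=d_{11}e_2+d_{11}e_3-d_{52}e_5$, $d(e_4)=d_{11}e_4+d_{54}e_5$, $d(e_5)=2d_{11}e_5$; $D(N)\simeq K\times K^3$. \item $N_{6,19}(\alpha,\beta)$: $d(e_1)=d_{11}e_1+d_{61}e_6$, $d(e_2)=d_{22}e_2+(2d_{11}-d_{22})e_3+d_{42}e_4+d_{52}e_5+d_{62}e_6$, $d(e_3)=(2d_{11}-d_{22})e_2+d_{22}e_3-d_{42}e_4-d_{52}e_5-d_{62}e_6$, $d(e_4)=-\alpha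 d_{42}e_2-\alpha d_{42}e_3+d_{22}e_4+d_{54}e_5+d_{64}e_6$, $d(e_5)=-\beta d_{52}e_2-\beta d_{52}e_3-\alpha^{-1}\beta d_{54}e_4+d_{22}e_5+d_{65}e_6$, $d(e_6)=2d_{22}e_6$; $D(N)\simeq K^5\times K^4$. \item $N_{6,20}(\alpha,\beta)$: $d(e_1)=d_{11}e_1+d_{41}e_4+d_{61}e_6$, $d(e_2)=d_{22}e_2+(2d_{11}-d_{22})e_3+d_{52}e_5+d_{62}e_6$, $d(e_3)=(2d_{11}-d_{22})e_2+d_{22}e_3-d_{52}e_5-d_{62}e_6$, $d(e_4)=-\alpha d_{41}e_1+d_{11}e_4+d_{64}e_6$, $d(e_5)=-\beta d_{52}e_2-\beta d_{52}e_3+d_{22}e_5+d_{65}e_6$, $d(e_6)=2d_{22}e_6$; $D(N)\simeq K^4\times K^4$. \item $N_{6,21}(\alpha,\beta,\gamma)$: $d(e_1)=d_{11}e_1+d_{61}e_6$, $d(e_2)=d_{11}e_2+d_{11}e_3+d_{52}e_5+d_{62}e_6$, $d(e_3)=d_{11}e_2+d_{11}e_3-d_{52}e_5-d_{62}e_6$,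 $d(e_4)=d_{11}e_4+d_{64}e_6$, $d(e_5)=-\gamma d_{52}e_2-\gamma d_{52}e_3+d_{11}e_5+d_{65}e_6$, $d(e_6)=2d_{11}e_6$; $D(N)\simeq K^2\times K^4$. \item $N_{6,22}(\alpha,\beta)$: $d(e_1)=d_{11}e_1+d_{41}e_4+d_{51}e_5+d_{61}e_6$, $d(e_2)=d_{22}e_2+(2d_{11}-d_{22})e_3+d_{62}e_6$, $d(e_3)=(2d_{11}-d_{22})e_2+d_{22}e_3-d_{62}e_6$, $d(e_4)=-\alpha d_{41}e_1+d_{11}e_4+d_{54}e_5+d_{64}e_6$, $d(e_5)=-\beta d_{51}e_1-\alpha^{-1}\beta d_{54}e_4+d_{11}e_5+d_{65}e_6$, $d(e_6)=2d_{22}e_6$; $D(N)\simeq K^5\times K^4$. \item $N_{6,23}(\alpha,\beta,\gamma,\delta)$: $d(e_1)=d_{11}e_1+d_{61}e_6$, $d(e_2)=d_{11}e_2+d_{11}e_3+d_{62}e_6$, $d(e_3)=d_{11}e_2+d_{11}e_3-d_{62}e_6$, $d(e_4)=d_{11}e_4+d_{64}e_6$, $d(e_5)=d_{11}e_5+d_{65}e_6$,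 $d(e_6)=2d_{11}e_6$; $D(N)\simeq K\times K^4$. \item $N_{6,24}(\alpha,\beta,\gamma)$: $d(e_1)=d_{11}e_1+d_{51}e_5+d_{61}e_6$, $d(e_2)=d_{11}e_2+d_{11}e_3+d_{62}e_6$, $d(e_3)=d_{11}e_2+d_{11}e_3-d_{62}e_6$, $d(e_4)=d_{11}e_4+d_{64}e_6$, $d(e_5)=-\gamma d_{51}e_1+d_{11}e_5+d_{65}e_6$, $d(e_6)=2d_{11}e_6$; $D(N)\simeq K^2\times K^4$. \end{itemize} -/

import Mathlib

/-!
Evolution algebras over a field `K`.  An algebra is a `K`-module `N` with a commutative, bilinear and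
not necessarily associative product.  Basis vectors are indexed from `0`: `e 0, …, e (n-1)` stand for
`e₁, …, eₙ`.
-/

namespace EvoAlg

open Module

section Notions

/-- `principalPower x k` is the principal power `x^(k+1)`: `x^1 = x` and `x^(k+1) = x^k * x`. -/
def principalPower {N : Type*} [Mul N] (x : N) : ℕ → N
  | 0 => x
  | k + 1 => principalPower x k * x

/-- Nil algebra: every element has a vanishing principal power. -/
def IsNilAlgebra (N : Type*) [NonUnitalNonAssocCommRing N] : Prop :=
  ∀ x : N, ∃ k : ℕ, principalPower x k = 0

/-- Power-associative algebra: `x^i * x^j = x^(i+j)` for all `x` and all `i, j ≥ 1`. -/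
def IsPowerAssociative (N : Type*) [NonUnitalNonAssocCommRing N] : Prop :=
  ∀ (x : N) (i j : ℕ),
    principalPower x i * principalPower x j = principalPower x (i + j + 1)

/-- Associative algebra. -/
def IsAssociative (N : Type*) [NonUnitalNonAssocCommRing N] : Prop :=
  ∀ x y z : N, (x * y) * z = x * (y * z)

variable (K : Type*) [Field K] (N : Type*) [NonUnitalNonAssocCommRing N] [Module K N]
  [IsScalarTower K N N] [SMulCommClass K N N]

/-- A basis is natural if products of distinct basis vectors vanish. -/
def IsNaturalBasis {K : Type*} [Field K] {N : Type*} [NonUnitalNonAssocCommRing N] [Module K N]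
    {n : ℕ} (e : Basis (Fin n) K N) : Prop :=
  ∀ i j : Fin n, i ≠ j → e i * e j = 0

/-- Evolution algebra (of finite dimension): there is a finite natural basis. -/
def IsEvolutionAlgebra : Prop :=
  ∃ (n : ℕ) (e : Basis (Fin n) K N), IsNaturalBasis e

/-- A (two-sided, by commutativity) ideal of the algebra. -/
def IsAlgebraIdeal {K : Type*} [Field K] {N : Type*} [NonUnitalNonAssocCommRing N] [Module K N]
    (I : Submodule K N) : Prop :=
  ∀ x ∈ I, ∀ y : N, x * y ∈ I

/-- Decomposable algebra: the direct sum of two nonzero ideals. -/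
def IsDecomposable : Prop :=
  ∃ I J : Submodule K N, IsAlgebraIdeal I ∧ IsAlgebraIdeal J ∧ I ≠ ⊥ ∧ J ≠ ⊥ ∧ IsCompl I J

/-- The annihilator `{x | x N = 0}`. -/
def algebraAnnihilator : Submodule K N where
  carrier := {x | ∀ y : N, x * y = 0}
  add_mem' := by
    intro a b ha hb y
    rw [add_mul, ha y, hb y, add_zero]
  zero_mem' := fun y => zero_mul y
  smul_mem' := by
    intro c x hx y
    rw [smul_mul_assoc, hx y, smul_zero]

/-- The space of derivations: the linear maps `d` with `d (u v) = u d(v) + d(u) v`. -/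
def derivations : Submodule K (Module.End K N) where
  carrier := {d | ∀ u v : N, d (u * v) = u * d v + d u * v}
  add_mem' := by
    intro a b ha hb u v
    simp only [LinearMap.add_apply, ha u v, hb u v, mul_add, add_mul]
    abel
  zero_mem' := by
    intro u v
    simp
  smul_mem' := by
    intro c d hd u v
    simp only [LinearMap.smul_apply, hd u v, smul_add, smul_mul_assoc, mul_smul_comm]

/-- Derivations are closed under the commutator, so they form a Lie algebra. -/
theorem commutator_mem_derivations {d d' : Module.End K N} (hd : d ∈ derivations K N)
    (hd' : d' ∈ derivations K N) : d * d' - d' * d ∈ derivations K N := by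
  intro u v
  have h : ∀ u v : N, d (u * v) = u * d v + d u * v := hd
  have h' : ∀ u v : N, d' (u * v) = u * d' v + d' u * v := hd'
  simp only [LinearMap.sub_apply, Module.End.mul_apply, h, h', map_add, mul_sub, sub_mul]
  abel

end Notions

section Tables

variable {K : Type*} [Field K] {N : Type*} [NonUnitalNonAssocCommRing N] [Module K N]

/-- `e` is a natural basis with the multiplication table of `N_{4,6}`. -/
def IsN46 (e : Basis (Fin 4) K N) : Prop :=
  IsNaturalBasis e ∧ e 0 * e 0 = e 1 + e 2 ∧ e 1 * e 1 = e 3 ∧ e 2 * e 2 = -e 3 ∧ e 3 * e 3 = 0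

/-- `e` is a natural basis with the multiplication table of `N_{5,10}(α)`. -/
def IsN510 (α : K) (e : Basis (Fin 5) K N) : Prop :=
  α ≠ 0 ∧ IsNaturalBasis e ∧ e 0 * e 0 = e 1 + e 2 ∧ e 1 * e 1 = e 4 ∧ e 2 * e 2 = -e 4 ∧
    e 3 * e 3 = α • e 4 ∧ e 4 * e 4 = 0

/-- `e` is a natural basis with the multiplication table of `N_{5,11}(α)`. -/
def IsN511 (α : K) (e : Basis (Fin 5) K N) : Prop :=
  α ≠ 0 ∧ IsNaturalBasis e ∧ e 0 * e 0 = e 1 + e 2 ∧ e 1 * e 1 = e 4 ∧ e 2 * e 2 = -e 4 ∧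
    e 3 * e 3 = α • (e 1 + e 2) ∧ e 4 * e 4 = 0

/-- `e` is a natural basis with the multiplication table of `N_{5,12}(α, β)`. -/
def IsN512 (α β : K) (e : Basis (Fin 5) K N) : Prop :=
  α ≠ 0 ∧ β ≠ 0 ∧ IsNaturalBasis e ∧ e 0 * e 0 = e 1 + e 2 ∧ e 1 * e 1 = e 4 ∧
    e 2 * e 2 = -e 4 ∧ e 3 * e 3 = α • (e 1 + e 2) + β • e 4 ∧ e 4 * e 4 = 0

/-- `e` is a natural basis with the multiplication table of `N_{6,19}(α, β)`. -/
def IsN619 (α β : K) (e : Basis (Fin 6) K N) : Prop :=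
  α ≠ 0 ∧ β ≠ 0 ∧ IsNaturalBasis e ∧ e 0 * e 0 = e 1 + e 2 ∧ e 1 * e 1 = e 5 ∧
    e 2 * e 2 = -e 5 ∧ e 3 * e 3 = α • e 5 ∧ e 4 * e 4 = β • e 5 ∧ e 5 * e 5 = 0

/-- `e` is a natural basis with the multiplication table of `N_{6,20}(α, β)`. -/
def IsN620 (α β : K) (e : Basis (Fin 6) K N) : Prop :=
  α ≠ 0 ∧ β ≠ 0 ∧ IsNaturalBasis e ∧ e 0 * e 0 = e 1 + e 2 ∧ e 1 * e 1 = e 5 ∧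
    e 2 * e 2 = -e 5 ∧ e 3 * e 3 = α • (e 1 + e 2) ∧ e 4 * e 4 = β • e 5 ∧ e 5 * e 5 = 0

/-- `e` is a natural basis with the multiplication table of `N_{6,21}(α, β, γ)`. -/
def IsN621 (α β γ : K) (e : Basis (Fin 6) K N) : Prop :=
  α ≠ 0 ∧ β ≠ 0 ∧ γ ≠ 0 ∧ IsNaturalBasis e ∧ e 0 * e 0 = e 1 + e 2 ∧ e 1 * e 1 = e 5 ∧
    e 2 * e 2 = -e 5 ∧ e 3 * e 3 = α • (e 1 + e 2) + β • e 5 ∧ e 4 * e 4 = γ • e 5 ∧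
    e 5 * e 5 = 0

/-- `e` is a natural basis with the multiplication table of `N_{6,22}(α, β)`. -/
def IsN622 (α β : K) (e : Basis (Fin 6) K N) : Prop :=
  α ≠ 0 ∧ β ≠ 0 ∧ IsNaturalBasis e ∧ e 0 * e 0 = e 1 + e 2 ∧ e 1 * e 1 = e 5 ∧
    e 2 * e 2 = -e 5 ∧ e 3 * e 3 = α • (e 1 + e 2) ∧ e 4 * e 4 = β • (e 1 + e 2) ∧
    e 5 * e 5 = 0

/-- `e` is a natural basis with the multiplication table of `N_{6,23}(α, β, γ, δ)`. -/
def IsN623 (α β γ δ : K) (e : Basis (Fin 6) K N) : Prop :=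
  α * δ - β * γ ≠ 0 ∧ α * γ ≠ 0 ∧ β * δ ≠ 0 ∧ IsNaturalBasis e ∧ e 0 * e 0 = e 1 + e 2 ∧
    e 1 * e 1 = e 5 ∧ e 2 * e 2 = -e 5 ∧ e 3 * e 3 = α • (e 1 + e 2) + β • e 5 ∧
    e 4 * e 4 = γ • (e 1 + e 2) + δ • e 5 ∧ e 5 * e 5 = 0

/-- `e` is a natural basis with the multiplication table of `N_{6,24}(α, β, γ)`. -/
def IsN624 (α β γ : K) (e : Basis (Fin 6) K N) : Prop :=
  α * β * γ ≠ 0 ∧ IsNaturalBasis e ∧ e 0 * e 0 = e 1 + e 2 ∧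
    e 1 * e 1 = e 5 ∧ e 2 * e 2 = -e 5 ∧ e 3 * e 3 = α • (e 1 + e 2) + β • e 5 ∧
    e 4 * e 4 = γ • (e 1 + e 2) ∧ e 5 * e 5 = 0

end Tables

end EvoAlg

open Module EvoAlg

/-! Write e_i² = ∑ a_ik e_k in a natural basis. Nilpotency of e_i forces a_ii e_i² = 0.
Power-associativity enters only through x²x² = ((x²)x)x, evaluated at signed sums of two or three
basis vectors; separating signs, which needs characteristic ≠ 2, gives e_i² e_j² = 0 and a_ik a_kl
e_l² = 0 (`sq_mul_sq_eq_zero`, `path_smul_sq_eq_zero`).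

A one-dimensional annihilator means that exactly one basis vector v has square zero. By the path
condition the basis then has three layers: v; vectors spanning U, with squares nonzero multiples of
v; and the rest, whose squares lie in U + Kv with nonzero U-component (`exists_layered_basis`).
Multiplication on U is a nondegenerate diagonal form with values in Kv, and e_i² e_j² = 0 says that
the U-components of third-layer squares are isotropic and pairwise orthogonal. Non-associativity
makes the third layer nonempty, so U contains a nonzero isotropic w. It splits as w = f₀ + f₁ with
f₀, f₁ orthogonal of opposite norms, and this pair extends to an orthogonal basis of U.

With m = dim U - 2 and q + 1 third-layer vectors, dimension at most 6 means m + q ≤ 2. If q > 0 then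
m ≤ 1, so all U-components are multiples of w; rescaling gives the normal form of
`exists_isNormalBasis`. The pairs (m, q), and the vanishing or not of the remaining coefficients,
give the tables.

Derivations solve a linear system. For i ≠ j, the relation e_i d(e_j) + d(e_i) e_j = 0 kills both
mixed entries unless e_i² and e_j² are linearly dependent; d(e_i²) = 2 e_i d(e_i) links the diagonal
entries. -/

namespace EvoAlg

/-! ### Structure constants under nilpotency and power-associativity -/

section Structure

variable {K : Type*} [Field K] {N : Type*} [NonUnitalNonAssocCommRing N] [Module K N]
  [IsScalarTower K N N] [SMulCommClass K N N] {n : ℕ} {e : Basis (Fin n) K N}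

theorem IsNaturalBasis.mul_basis (he : IsNaturalBasis e) (x : N) (j : Fin n) :
    x * e j = e.repr x j • (e j * e j) := by
  conv_lhs => rw [← e.sum_repr x, Finset.sum_mul]
  rw [Finset.sum_eq_single j]
  · rw [smul_mul_assoc]
  · intro i _ hij
    rw [smul_mul_assoc, he i j hij, smul_zero]
  · simp

theorem IsNaturalBasis.mul_eq_sum (he : IsNaturalBasis e) (x y : N) :
    x * y = ∑ j, (e.repr x j * e.repr y j) • (e j * e j) := by
  conv_lhs => rw [← e.sum_repr y, Finset.mul_sum]
  refine Finset.sum_congr rfl fun j _ => ?_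
  rw [mul_smul_comm, he.mul_basis, smul_smul, mul_comm]

/-- Each further multiplication of e_i² by e_i only multiplies it by a_ii, so a vanishing power
forces a_ii = 0 or e_i² = 0. -/
theorem IsNaturalBasis.repr_self_smul_sq_eq_zero (he : IsNaturalBasis e) (hnil : IsNilAlgebra N)
    (i : Fin n) : e.repr (e i * e i) i • (e i * e i) = 0 := by
  obtain ⟨k, hk⟩ := hnil (e i)
  have key : ∀ k, principalPower (e i) (k + 1) = e.repr (e i * e i) i ^ k • (e i * e i) := by
    intro k
    induction k with
    | zero => simp [principalPower]
    | succ k ih =>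
      rw [principalPower, ih, smul_mul_assoc, he.mul_basis (e i * e i) i, smul_smul, ← pow_succ]
  cases k with
  | zero => exact absurd hk (e.ne_zero i)
  | succ k =>
    rw [key] at hk
    rcases smul_eq_zero.1 hk with h | h
    · rw [eq_zero_of_pow_eq_zero h, zero_smul]
    · rw [h, smul_zero]

theorem IsPowerAssociative.sq_mul_sq (hpa : IsPowerAssociative N) (x : N) :
    (x * x) * (x * x) = ((x * x) * x) * x :=
  hpa x 1 1

/-- With s = e_i², t = e_j², a = a_ij, b = a_ji, the fourth-power identity at e_i ± e_j reads 2st =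
±ab(s + t). Adding the two gives 4st = 0, and then ab(s + t) = 0. -/
theorem IsNaturalBasis.sq_mul_sq_eq_zero (h2 : (2 : K) ≠ 0) (he : IsNaturalBasis e)
    (hnil : IsNilAlgebra N) (hpa : IsPowerAssociative N) (i j : Fin n) :
    (e i * e i) * (e j * e j) = 0 ∧ e.repr (e i * e i) j * e.repr (e j * e j) i = 0 := by
  have hii := he.repr_self_smul_sq_eq_zero hnil
  have hss : ∀ i, (e i * e i) * (e i * e i) = 0 := fun i => by
    rw [hpa.sq_mul_sq, he.mul_basis (e i * e i) i, hii, zero_mul]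
  by_cases hij : i = j
  · subst hij
    refine ⟨hss i, ?_⟩
    have := congrArg (fun x => e.repr x i) (hii i)
    simpa using this
  have m := he.mul_basis
  have hij' := he i j hij
  have hji' := he j i (Ne.symm hij)
  set s := e i * e i with hs
  set t := e j * e j with ht
  set a := e.repr s j
  set b := e.repr t i
  have e1 : s * e i = 0 := by rw [m s i, hii]
  have e2 : t * e j = 0 := by rw [m t j, hii]
  have e3 : s * e j = a • t := m s j
  have e4 : t * e i = b • s := m t i
  have e5 : s * s = 0 := hss i
  have e6 : t * t = 0 := hss j
  have e7 : t * s = s * t := mul_comm _ _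
  have P := hpa.sq_mul_sq (e i + e j)
  have M := hpa.sq_mul_sq (e i - e j)
  simp only [add_mul, mul_add, sub_mul, mul_sub, hij', hji', ← hs, ← ht, e1, e2, e3, e4, e5, e6, e7,
    smul_mul_assoc, smul_zero, add_zero, zero_add, sub_zero, zero_sub, sub_neg_eq_add,
    smul_smul] at P M
  have h1 : (4 : K) • (s * t) = 0 := by
    linear_combination (norm := module) P + M
  have h3 : s * t = 0 := by
    rcases smul_eq_zero.1 h1 with h | h
    · exact absurd h (by rw [show (4 : K) = 2 * 2 by norm_num]; exact mul_ne_zero h2 h2)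
    · exact h
  refine ⟨h3, ?_⟩
  rw [h3] at P
  have h4 : (a * b) • (s + t) = 0 := by
    linear_combination (norm := module) -P
  rcases smul_eq_zero.1 h4 with h | h
  · exact h
  -- If t = -s, then b = -a_ii, and a_ii s = 0 makes b or a vanish.
  · have hb : b = - e.repr s i := by
      have : t = -s := by rw [eq_neg_iff_add_eq_zero, add_comm, h]
      simp [b, this]
    rcases smul_eq_zero.1 (hii i) with h5 | h5
    · rw [hb, h5, neg_zero, mul_zero]
    · simp [a, hs, h5]

/-- In the graph with an arrow i → k when a_ik ≠ 0, every path of length two ends at a vector of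
square zero. For distinct vertices, the term comes from the fourth power of e_i ± e_k ± e_l. -/
theorem IsNaturalBasis.path_smul_sq_eq_zero (h2 : (2 : K) ≠ 0) (he : IsNaturalBasis e)
    (hnil : IsNilAlgebra N) (hpa : IsPowerAssociative N) (i k l : Fin n) :
    (e.repr (e i * e i) k * e.repr (e k * e k) l) • (e l * e l) = 0 := by
  have hii := he.repr_self_smul_sq_eq_zero hnil
  have hsq := he.sq_mul_sq_eq_zero h2 hnil hpa
  have hii' : ∀ i k, e.repr (e i * e i) i * e.repr (e i * e i) k = 0 := fun i k => by
    simpa using congrArg (fun x => e.repr x k) (hii i)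
  by_cases hik : i = k
  · subst hik
    rw [hii', zero_smul]
  by_cases hkl : k = l
  · subst hkl
    rw [mul_smul, hii, smul_zero]
  by_cases hil : i = l
  · subst hil
    rw [(hsq i k).2, zero_smul]
  have hkl2 := (hsq k l).2
  rcases mul_eq_zero.1 hkl2 with h | h
  · rw [h, mul_zero, zero_smul]
  have m := he.mul_basis
  have x1 := he i k hik
  have x2 := he k l hkl
  have x3 := he i l hil
  have x1' := he k i (Ne.symm hik)
  have x2' := he l k (Ne.symm hkl)
  have x3' := he l i (Ne.symm hil)
  have A1 := (hsq i i).1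
  have A2 := (hsq k k).1
  have A3 := (hsq l l).1
  have A4 := (hsq i k).1
  have A5 := (hsq i l).1
  have A6 := (hsq k l).1
  have A4' := (hsq k i).1
  have A5' := (hsq l i).1
  have A6' := (hsq l k).1
  have B1 := (hsq i k).2
  have B2 := (hsq i l).2
  have C1 : (e i * e i) * e i = 0 := by rw [m (e i * e i) i, hii]
  have C2 : (e k * e k) * e k = 0 := by rw [m (e k * e k) k, hii]
  have C3 : (e l * e l) * e l = 0 := by rw [m (e l * e l) l, hii]
  have D1 := m (e i * e i) k
  have D2 := m (e i * e i) l
  have D3 := m (e k * e k) i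
  have D4 := m (e k * e k) l
  have D5 := m (e l * e l) i
  have D6 := m (e l * e l) k
  set s := e i * e i with hs
  set t := e k * e k with ht
  set u := e l * e l with hu
  rw [h, zero_smul] at D6
  have P1 := hpa.sq_mul_sq (e i + e k + e l)
  have P2 := hpa.sq_mul_sq (e i - e k + e l)
  have P3 := hpa.sq_mul_sq (e i + e k - e l)
  have P4 := hpa.sq_mul_sq (e i - e k - e l)
  simp only [add_mul, mul_add, sub_mul, mul_sub, x1, x2, x3, x1', x2', x3', ← hs, ← ht, ← hu,
    A1, A2, A3, A4, A5, A6, A4', A5', A6', C1, C2, C3, D1, D2, D3, D4, D5, D6,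
    smul_mul_assoc, smul_zero, add_zero, zero_add, sub_zero, zero_sub, sub_neg_eq_add,
    smul_smul] at P1 P2 P3 P4
  -- For x = e_i + σe_k + τe_l this combination isolates the coefficient of στ in x⁴. Paths through
  -- l to k would also contribute, but a_lk = 0 here, which leaves a_ik a_kl e_l².
  have h4 : (4 : K) • ((e.repr s k * e.repr t l) • u) = 0 := by
    linear_combination (norm := module) -P1 + P2 + P3 - P4
  rcases smul_eq_zero.1 h4 with h | h
  · exact absurd h (by rw [show (4 : K) = 2 * 2 by norm_num]; exact mul_ne_zero h2 h2)
  · exact h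

theorem IsNaturalBasis.mem_algebraAnnihilator_iff (he : IsNaturalBasis e) (x : N) :
    x ∈ algebraAnnihilator K N ↔ ∀ j, e.repr x j = 0 ∨ e j * e j = 0 := by
  constructor
  · intro hx j
    have := hx (e j)
    rw [he.mul_basis] at this
    exact smul_eq_zero.1 this
  · intro h y
    rw [he.mul_eq_sum]
    refine Finset.sum_eq_zero fun j _ => ?_
    rcases h j with h | h
    · rw [h, zero_mul, zero_smul]
    · rw [h, smul_zero]

theorem IsNaturalBasis.existsUnique_sq_eq_zero (he : IsNaturalBasis e)
    (hann : finrank K (algebraAnnihilator K N) = 1) : ∃! z, e z * e z = 0 := by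
  have hmem : ∀ j, e j * e j = 0 → e j ∈ algebraAnnihilator K N := fun j hj => by
    rw [he.mem_algebraAnnihilator_iff]
    intro k
    by_cases hjk : j = k
    · exact Or.inr (hjk ▸ hj)
    · exact Or.inl (by rw [Basis.repr_self, Finsupp.single_eq_of_ne' hjk])
  obtain ⟨x, hx0, hx⟩ := finrank_eq_one_iff'.1 hann
  have hxa := (he.mem_algebraAnnihilator_iff (x : N)).1 x.2
  obtain ⟨z, hz⟩ : ∃ z, e z * e z = 0 := by
    by_contra! hne
    refine hx0 (Subtype.ext (e.repr.injective (Finsupp.ext fun j => ?_)))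
    simpa using (hxa j).resolve_right (hne j)
  refine ⟨z, hz, fun j hj => ?_⟩
  by_contra hjz
  obtain ⟨a, ha⟩ := hx ⟨e z, hmem z hz⟩
  obtain ⟨b, hb⟩ := hx ⟨e j, hmem j hj⟩
  have ha' : a • (x : N) = e z := congrArg Subtype.val ha
  have hb' : b • (x : N) = e j := congrArg Subtype.val hb
  have h1 : b • e z = a • e j := by rw [← ha', ← hb', smul_smul, smul_smul, mul_comm]
  have h3 := congrArg (fun y => e.repr y z) h1
  simp [Finsupp.single_eq_of_ne' hjz] at h3
  rw [h3, zero_smul] at hb'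
  exact e.ne_zero j hb'.symm

/-- Otherwise every e_i² annihilates every e_k, all triple products vanish, and the algebra is
associative. -/
theorem IsNaturalBasis.exists_repr_ne_zero (he : IsNaturalBasis e) (hna : ¬ IsAssociative N) :
    ∃ i k, e.repr (e i * e i) k ≠ 0 ∧ e k * e k ≠ 0 := by
  by_contra! H
  have key : ∀ i k, (e i * e i) * e k = 0 := fun i k => by
    rw [he.mul_basis (e i * e i) k]
    by_cases h : e.repr (e i * e i) k = 0
    · rw [h, zero_smul]
    · rw [H i k h, smul_zero]
  have key2 : ∀ x y z : N, (x * y) * z = 0 := fun x y z => by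
    rw [he.mul_eq_sum x y, Finset.sum_mul]
    refine Finset.sum_eq_zero fun j _ => ?_
    rw [smul_mul_assoc, ← e.sum_repr z, Finset.mul_sum]
    simp [mul_smul_comm, key]
  exact hna fun x y z => by rw [key2, mul_comm x, key2]

end Structure

/-! ### Linear algebra: isotropic vectors and changes of basis -/

/-- A finite type splits into two pieces and a distinguished point, according to a predicate. -/
theorem exists_equiv_fin_sum_fin_sum_unit {ι : Type*} [Finite ι] (z : ι) (P : ι → Prop) :
    ∃ (p q : ℕ) (ε : Fin p ⊕ Fin q ⊕ Unit ≃ ι), ε (.inr (.inr ())) = z ∧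
      (∀ k, P (ε (.inl k)) ∧ ε (.inl k) ≠ z) ∧
      ∀ i, ¬ P (ε (.inr (.inl i))) ∧ ε (.inr (.inl i)) ≠ z := by
  classical
  have := Fintype.ofFinite ι
  let a := (Fintype.equivFin {i : ι // P i ∧ i ≠ z}).symm
  let b := (Fintype.equivFin {i : ι // ¬ P i ∧ i ≠ z}).symm
  let φ : Fin (Fintype.card {i : ι // P i ∧ i ≠ z}) ⊕
      Fin (Fintype.card {i : ι // ¬ P i ∧ i ≠ z}) ⊕ Unit → ι :=
    Sum.elim (fun k => (a k).1) (Sum.elim (fun k => (b k).1) fun _ => z)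
  have hφ : Function.Bijective φ := by
    constructor
    · rintro (i | i | i) (j | j | j) h <;> simp only [φ, Sum.elim_inl, Sum.elim_inr] at h
      · rw [a.injective (Subtype.ext h)]
      · exact absurd (h ▸ (a i).2.1) (b j).2.1
      · exact absurd h (a i).2.2
      · exact absurd (h ▸ (a j).2.1) (b i).2.1
      · rw [b.injective (Subtype.ext h)]
      · exact absurd h (b i).2.2
      · exact absurd h.symm (a j).2.2
      · exact absurd h.symm (b j).2.2
      · rfl
    · intro i
      by_cases hz : i = z
      · exact ⟨.inr (.inr ()), hz.symm⟩
      by_cases hP : P i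
      · exact ⟨.inl (a.symm ⟨i, hP, hz⟩), by simp [φ]⟩
      · exact ⟨.inr (.inl (b.symm ⟨i, hP, hz⟩)), by simp [φ]⟩
  exact ⟨_, _, Equiv.ofBijective φ hφ, rfl, fun k => (a k).2, fun i => (b i).2⟩

/-- An isotropic vector of a nondegenerate symmetric bilinear form is the sum of two orthogonal
vectors of opposite nonzero norms. -/
theorem exists_orthogonal_pair_of_isotropic {K V : Type*} [Field K] (h2 : (2 : K) ≠ 0)
    [AddCommGroup V] [Module K V] (B : LinearMap.BilinForm K V)
    (hsymm : ∀ x y, B x y = B y x) (hnd : ∀ x, (∀ y, B x y = 0) → x = 0) (w : V) (hw : w ≠ 0)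
    (hww : B w w = 0) :
    ∃ (f0 f1 : V) (q : K), f0 + f1 = w ∧ q ≠ 0 ∧ B f0 f0 = q ∧ B f1 f1 = -q ∧ B f0 f1 = 0 := by
  obtain ⟨y, hy⟩ : ∃ y, B w y ≠ 0 := by
    by_contra! H
    exact hw (hnd w H)
  obtain ⟨w', hw'w', hww'⟩ : ∃ w', B w' w' = 0 ∧ B w w' ≠ 0 := by
    -- Subtracting this multiple of w makes y isotropic and leaves its pairing with w unchanged, so
    -- w, w' is a hyperbolic pair up to scale.
    refine ⟨y - (B y y / (2 * B w y)) • w, ?_, ?_⟩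
    · simp only [map_sub, map_smul, LinearMap.sub_apply, LinearMap.smul_apply, hww, smul_eq_mul,
        hsymm y w]
      field_simp
      ring
    · simpa [hww] using hy
  let f0 := (2⁻¹ : K) • (w + w')
  let f1 := (2⁻¹ : K) • (w - w')
  have hsum : f0 + f1 = w := by
    simp only [f0, f1, ← smul_add, add_add_sub_cancel, ← two_smul K w]
    rw [smul_smul, inv_mul_cancel₀ h2, one_smul]
  refine ⟨f0, f1, 2⁻¹ * B w w', hsum, mul_ne_zero (inv_ne_zero h2) hww', ?_, ?_, ?_⟩ <;>
  · simp only [f0, f1, map_sub, map_add, map_smul, LinearMap.sub_apply, LinearMap.add_apply,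
      LinearMap.smul_apply, hww, smul_eq_mul, hsymm w' w, hw'w']
    field_simp
    ring

/-- An isotropic vector of a nondegenerate symmetric bilinear form is the sum of the first two
members of an orthogonal basis. -/
theorem exists_orthogonal_basis_of_isotropic {K V : Type*} [Field K] (h2 : (2 : K) ≠ 0)
    [AddCommGroup V] [Module K V] [FiniteDimensional K V] (B : LinearMap.BilinForm K V)
    (hs : B.IsSymm) (hnd : ∀ x, (∀ y, B x y = 0) → x = 0) (w : V) (hw : w ≠ 0) (hww : B w w = 0) :
    ∃ (m : ℕ) (f : Basis (Fin 2 ⊕ Fin m) K V), (∀ i j, i ≠ j → B (f i) (f j) = 0) ∧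
      (∀ i, B (f i) (f i) ≠ 0) ∧ f (.inl 0) + f (.inl 1) = w ∧
      B (f (.inl 1)) (f (.inl 1)) = - B (f (.inl 0)) (f (.inl 0)) := by
  have hsymm : ∀ x y, B x y = B y x := fun x y => by simpa using hs.eq x y
  obtain ⟨f0, f1, q, hsum, hq, h00, h11, h01⟩ :=
    exists_orthogonal_pair_of_isotropic h2 B hsymm hnd w hw hww
  have h10 : B f1 f0 = 0 := by rw [hsymm, h01]
  -- W is the orthogonal complement of the plane of f0 and f1. The space is their direct sum via T,
  -- and W has an orthogonal basis because 2 is invertible.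
  let W : Submodule K V := LinearMap.ker (B f0) ⊓ LinearMap.ker (B f1)
  have hW : ∀ x ∈ W, B f0 x = 0 ∧ B f1 x = 0 := fun x hx => by simpa [W] using hx
  let T : ((Fin 2 → K) × W) →ₗ[K] V :=
    (Fintype.linearCombination K ![f0, f1]).coprod W.subtype
  have hT : ∀ x, T x = x.1 0 • f0 + x.1 1 • f1 + x.2 := fun x => by
    simp [T, Fintype.linearCombination_apply, Fin.sum_univ_two]
  have hbij : Function.Bijective T := by
    constructor
    · rw [← LinearMap.ker_eq_bot, LinearMap.ker_eq_bot']
      rintro ⟨a, x⟩ h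
      rw [hT] at h
      obtain ⟨x0, x1⟩ := hW x x.2
      have a0 := congrArg (B f0) h
      have a1 := congrArg (B f1) h
      simp [h00, h01, h10, h11, x0, x1, hq] at a0 a1
      have hx : x = 0 := Subtype.ext (by simpa [a0, a1] using h)
      have ha : a = 0 := by
        ext i
        fin_cases i <;> simp [a0, a1]
      rw [ha, hx]
      rfl
    · intro x
      refine ⟨(![B f0 x / q, -(B f1 x / q)],
        ⟨x - (B f0 x / q) • f0 + (B f1 x / q) • f1, ?_⟩), ?_⟩
      · simp [W, h00, h01, h10, h11, hq]
      · rw [hT]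
        simp only [Matrix.cons_val_zero, Matrix.cons_val_one]
        module
  have : Invertible (2 : K) := invertibleOfNonzero h2
  obtain ⟨h, hh⟩ := LinearMap.BilinForm.exists_orthogonal_basis (B := B.domRestrict₁₂ W W)
    ⟨fun x y => hsymm x y⟩
  let f := ((Pi.basisFun K (Fin 2)).prod h).map (LinearEquiv.ofBijective T hbij)
  have fl : ∀ i, f (.inl i) = ![f0, f1] i := fun i => by
    fin_cases i <;> simp [f, hT]
  have fr : ∀ i, f (.inr i) = h i := fun i => by simp [f, hT]
  have hort : ∀ i j, i ≠ j → B (f i) (f j) = 0 := by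
    have key : ∀ i j, B (f (.inl i)) (f (.inr j)) = 0 := fun i j => by
      rw [fl, fr]
      fin_cases i
      · exact (hW _ (h j).2).1
      · exact (hW _ (h j).2).2
    rintro (i | i) (j | j) hij
    · rw [fl, fl]
      fin_cases i <;> fin_cases j
      · exact absurd rfl hij
      · exact h01
      · exact h10
      · exact absurd rfl hij
    · exact key i j
    · rw [hsymm, key]
    · rw [fr, fr]
      exact hh fun h => hij (by rw [h])
  -- An isotropic member of an orthogonal basis would lie in the radical, which is zero.
  refine ⟨_, f, hort, fun i hi => f.ne_zero i (hnd _ fun y => ?_), ?_, ?_⟩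
  · rw [← f.sum_repr y, map_sum]
    refine Finset.sum_eq_zero fun j _ => ?_
    rw [map_smul]
    by_cases hij : i = j
    · rw [← hij, hi, smul_zero]
    · rw [hort i j hij, smul_zero]
  · rw [fl, fl]
    exact hsum
  · rw [fl, fl]
    simp [h00, h11]

/-- Rescaling the members of a basis and adding multiples of one of them to the others. -/
theorem exists_basis_smul_add_smul {ι K V : Type*} [Field K] [AddCommGroup V] [Module K V]
    (g : Basis ι K V) (z : ι) (a c : ι → K) (ha : ∀ i, a i ≠ 0) (hc : c z = 0) :
    ∃ g' : Basis ι K V, ∀ i, g' i = a i • g i + c i • g z := by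
  let φ : Dual K V := g.constr K fun i => (a i)⁻¹ * c i
  have hφ : ∀ i, φ (g i) = (a i)⁻¹ * c i := fun i => g.constr_basis K _ i
  have hz : φ (g z) = 0 := by rw [hφ, hc, mul_zero]
  refine ⟨(g.map (LinearEquiv.transvection hz)).isUnitSMul fun i => (ha i).isUnit, fun i => ?_⟩
  rw [Basis.isUnitSMul_apply, Basis.map_apply, LinearEquiv.transvection.apply, hφ, smul_add,
    smul_smul, mul_inv_cancel_left₀ (ha i)]

/-! ### The three layers and isotropic vectors in the middle one -/

section NormalForm

variable {K : Type*} [Field K] {N : Type*} [NonUnitalNonAssocCommRing N] [Module K N]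
  [IsScalarTower K N N] [SMulCommClass K N N]

/-- A natural basis consisting of vectors with squares on the line of an annihilating vector `v`,
of vectors with squares in general position, and of `v`. -/
theorem IsNaturalBasis.exists_layered_basis {n : ℕ} {e : Basis (Fin n) K N} (h2 : (2 : K) ≠ 0)
    (he : IsNaturalBasis e) (hnil : IsNilAlgebra N) (hpa : IsPowerAssociative N)
    (hna : ¬ IsAssociative N) (hann : finrank K (algebraAnnihilator K N) = 1) :
    ∃ (p q : ℕ) (g : Basis (Fin p ⊕ Fin q ⊕ Unit) K N) (c : Fin p → K) (a : Fin q → Fin p → K)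
      (α : Fin q → K), (∀ i j, i ≠ j → g i * g j = 0) ∧
      g (.inr (.inr ())) * g (.inr (.inr ())) = 0 ∧
      (∀ k, c k ≠ 0 ∧ g (.inl k) * g (.inl k) = c k • g (.inr (.inr ()))) ∧
      (∀ i, a i ≠ 0 ∧ g (.inr (.inl i)) * g (.inr (.inl i)) =
        (∑ k, a i k • g (.inl k)) + α i • g (.inr (.inr ()))) ∧
      (∀ i j, ∑ k, a i k * a j k * c k = 0) ∧ 0 < q := by
  obtain ⟨z, hz, hzu⟩ := he.existsUnique_sq_eq_zero hann
  have hpath := he.path_smul_sq_eq_zero h2 hnil hpa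
  obtain ⟨p, q, ε, εz, εA, εB⟩ :=
    exists_equiv_fin_sum_fin_sum_unit z fun i => ∀ l, l ≠ z → e.repr (e i * e i) l = 0
  have hsq : ∀ x : N, x = (∑ k, e.repr x (ε (.inl k)) • e (ε (.inl k))) +
      ((∑ k, e.repr x (ε (.inr (.inl k))) • e (ε (.inr (.inl k)))) + e.repr x z • e z) := by
    intro x
    conv_lhs => rw [← e.sum_repr x, ← ε.sum_comp]
    rw [Fintype.sum_sum_type, Fintype.sum_sum_type, Fintype.sum_unique (ι := Unit)]
    simp [εz]
  have hA : ∀ k, e (ε (.inl k)) * e (ε (.inl k)) =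
      e.repr (e (ε (.inl k)) * e (ε (.inl k))) z • e z := fun k => by
    refine e.repr.injective (Finsupp.ext fun l => ?_)
    by_cases hl : l = z
    · simp [hl]
    · rw [(εA k).1 l hl]
      simp [Finsupp.single_eq_of_ne hl]
  -- A third-layer vector j has an arrow to some l ≠ z, where e_l² ≠ 0; an arrow into j would
  -- complete a forbidden path.
  have hB : ∀ i j, j ≠ z → (∃ l, l ≠ z ∧ e.repr (e j * e j) l ≠ 0) →
      e.repr (e i * e i) j = 0 := by
    rintro i j - ⟨l, hlz, hl⟩
    rcases smul_eq_zero.1 (hpath i j l) with h | h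
    · exact (mul_eq_zero.1 h).resolve_right hl
    · exact absurd (hzu l h) hlz
  have hB' : ∀ i j, e.repr (e i * e i) (ε (.inr (.inl j))) = 0 := fun i j => by
    have := (εB j).1
    push Not at this
    exact hB _ _ (εB j).2 this
  have hsB : ∀ i, e i * e i = (∑ k, e.repr (e i * e i) (ε (.inl k)) • e (ε (.inl k))) +
      e.repr (e i * e i) z • e z := fun i => by
    conv_lhs => rw [hsq (e i * e i)]
    simp [hB']
  have hez : e z ≠ 0 := e.ne_zero z
  refine ⟨p, q, e.reindex ε.symm, fun k => e.repr (e (ε (.inl k)) * e (ε (.inl k))) z,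
    fun i k => e.repr (e (ε (.inr (.inl i))) * e (ε (.inr (.inl i)))) (ε (.inl k)),
    fun i => e.repr (e (ε (.inr (.inl i))) * e (ε (.inr (.inl i)))) z, ?_, ?_, ?_, ?_, ?_, ?_⟩
  · intro i j hij
    simpa using he _ _ (ε.injective.ne hij)
  · simpa [εz] using hz
  · intro k
    refine ⟨fun h => ?_, by simpa [εz] using hA k⟩
    have := hA k
    rw [show e.repr (e (ε (.inl k)) * e (ε (.inl k))) z = 0 from h, zero_smul] at this
    exact (εA k).2 (hzu _ this)
  · intro i
    refine ⟨fun h => ?_, by simpa [εz] using hsB _⟩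
    have := (εB i).1
    push Not at this
    obtain ⟨l, hlz, hl⟩ := this
    obtain ⟨x, rfl⟩ := ε.surjective l
    rcases x with k | k | k
    · exact hl (congrFun h k)
    · exact hl (hB' _ k)
    · exact hlz εz
  · intro i j
    -- The product of two third-layer squares is the form applied to their middle components, times
    -- e z.
    have h := (he.sq_mul_sq_eq_zero h2 hnil hpa (ε (.inr (.inl i))) (ε (.inr (.inl j)))).1
    rw [he.mul_eq_sum, ← ε.sum_comp, Fintype.sum_sum_type, Fintype.sum_sum_type,
      Fintype.sum_unique (ι := Unit)] at h
    simp only [hB', zero_mul, zero_smul, Finset.sum_const_zero, zero_add] at h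
    rw [show (default : Unit) = () from rfl, εz, hz, smul_zero, add_zero] at h
    have h' := congrArg (fun y => e.repr y z) h
    simpa using h'
  · obtain ⟨i, k, hik, hk⟩ := he.exists_repr_ne_zero hna
    obtain ⟨x, rfl⟩ := ε.surjective i
    rcases x with x | x | x
    · refine absurd ((εA x).1 k ?_) hik
      rintro rfl
      exact hk hz
    · exact x.pos
    · rw [show x = () from rfl, εz, hz] at hik
      simp at hik

/-- The common shape of the multiplication tables: a natural basis `f₀, f₁`, `h i`, `b i`, `v` with
`f₀² = v = -f₁²`, `(h i)² ∈ K v`, `(b 0)² = f₀ + f₁`, `(b i)² ∈ K (f₀ + f₁) + K v`, `v² = 0`. -/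
structure IsNormalBasis {m q : ℕ} (g : Basis ((Fin 2 ⊕ Fin m) ⊕ Fin (q + 1) ⊕ Unit) K N)
    (c : Fin m → K) (b α : Fin q → K) : Prop where
  mul_eq_zero : ∀ i j, i ≠ j → g i * g j = 0
  sq_last : g (.inr (.inr ())) * g (.inr (.inr ())) = 0
  sq_zero : g (.inl (.inl 0)) * g (.inl (.inl 0)) = g (.inr (.inr ()))
  sq_one : g (.inl (.inl 1)) * g (.inl (.inl 1)) = -g (.inr (.inr ()))
  coeff_ne_zero : ∀ i, c i ≠ 0
  sq_line : ∀ i, g (.inl (.inr i)) * g (.inl (.inr i)) = c i • g (.inr (.inr ()))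
  sq_first : g (.inr (.inl 0)) * g (.inr (.inl 0)) = g (.inl (.inl 0)) + g (.inl (.inl 1))
  slope_ne_zero : ∀ i, b i ≠ 0
  sq_succ : ∀ i : Fin q, g (.inr (.inl i.succ)) * g (.inr (.inl i.succ)) =
    b i • (g (.inl (.inl 0)) + g (.inl (.inl 1))) + α i • g (.inr (.inr ()))

/-- Two isotropic vectors orthogonal to each other are proportional when the orthogonal complement
of the hyperbolic plane has dimension at most one. -/
theorem eq_smul_of_isotropic {V : Type*} [AddCommGroup V] [Module K V]
    (B : LinearMap.BilinForm K V) {m : ℕ} (hm : m ≤ 1) (f : Basis (Fin 2 ⊕ Fin m) K V)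
    (hort : ∀ i j, i ≠ j → B (f i) (f j) = 0) (hne : ∀ i, B (f i) (f i) ≠ 0)
    (hopp : B (f (.inl 1)) (f (.inl 1)) = - B (f (.inl 0)) (f (.inl 0))) (x : V)
    (hxw : B (f (.inl 0) + f (.inl 1)) x = 0) (hxx : B x x = 0) :
    ∃ b : K, x = b • (f (.inl 0) + f (.inl 1)) := by
  have hx := f.sum_repr x
  rw [Fintype.sum_sum_type, Fin.sum_univ_two] at hx
  set r := f.repr x
  have hcoord : ∀ i, B (f i) x = r i * B (f i) (f i) := fun i => by
    conv_lhs => rw [← f.sum_repr x, map_sum]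
    rw [Finset.sum_eq_single i]
    · simp [r]
    · intro j _ hij
      rw [map_smul, hort i j hij.symm, smul_zero]
    · simp
  -- Orthogonality to w equates the first two coordinates. Their contributions to B x x then cancel,
  -- leaving at most one term r²B, which must vanish.
  have h01 : r (.inl 1) = r (.inl 0) := by
    rw [map_add, LinearMap.add_apply, hcoord, hcoord, hopp] at hxw
    have : (r (.inl 0) - r (.inl 1)) * B (f (.inl 0)) (f (.inl 0)) = 0 := by
      linear_combination hxw
    exact (sub_eq_zero.1 ((mul_eq_zero.1 this).resolve_right (hne _))).symm
  have hrest : ∀ i, r (.inr i) = 0 := by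
    have : B x x = ∑ i, r i * (r i * B (f i) (f i)) := by
      have : ∀ y, B y x = ∑ i, f.repr y i * (r i * B (f i) (f i)) := fun y => by
        conv_lhs => rw [← f.sum_repr y]
        rw [map_sum, LinearMap.sum_apply]
        refine Finset.sum_congr rfl fun i _ => ?_
        rw [map_smul, LinearMap.smul_apply, hcoord, smul_eq_mul]
      exact this x
    rw [hxx, Fintype.sum_sum_type, Fin.sum_univ_two, h01, hopp] at this
    intro i
    have hsub : Subsingleton (Fin m) := Fin.subsingleton_iff_le_one.2 hm
    have hs : ∑ j, r (.inr j) * (r (.inr j) * B (f (.inr j)) (f (.inr j))) =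
        r (.inr i) * (r (.inr i) * B (f (.inr i)) (f (.inr i))) :=
      Fintype.sum_subsingleton _ i
    have h0 : r (.inr i) * (r (.inr i) * B (f (.inr i)) (f (.inr i))) = 0 := by
      rw [← hs]
      linear_combination -this
    rcases mul_eq_zero.1 h0 with h | h
    · exact h
    · exact (mul_eq_zero.1 h).resolve_right (hne _)
  refine ⟨r (.inl 0), ?_⟩
  rw [← hx, h01]
  simp [hrest]

end NormalForm

/-! ### Reduction to the common normal form -/

section NormalForm

variable {K : Type*} [Field K] {N : Type*} [NonUnitalNonAssocCommRing N] [Module K N]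
  [IsScalarTower K N N] [SMulCommClass K N N]

/-- The symmetric bilinear form with diagonal Gram matrix `c`. -/
def diagonalForm {p : ℕ} (c : Fin p → K) : LinearMap.BilinForm K (Fin p → K) :=
  LinearMap.mk₂ K (fun x y => ∑ k, x k * y k * c k)
    (fun x y z => by simp [add_mul, Finset.sum_add_distrib])
    (fun r x y => by simp [Finset.mul_sum, mul_assoc])
    (fun x y z => by simp [add_mul, mul_add, Finset.sum_add_distrib])
    (fun r x y => by simp [Finset.mul_sum, mul_assoc, mul_left_comm])

theorem diagonalForm_apply {p : ℕ} (c x y : Fin p → K) :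
    diagonalForm c x y = ∑ k, x k * y k * c k := rfl

theorem diagonalForm_isSymm {p : ℕ} (c : Fin p → K) : (diagonalForm c).IsSymm :=
  ⟨fun x y => by simp [diagonalForm_apply, mul_comm (x _)]⟩

theorem eq_zero_of_diagonalForm_eq_zero {p : ℕ} {c : Fin p → K} (hc : ∀ k, c k ≠ 0)
    (x : Fin p → K) (h : ∀ y, diagonalForm c x y = 0) : x = 0 := by
  ext k
  have := h (Pi.single k 1)
  rw [diagonalForm_apply, Finset.sum_eq_single k] at this
  · simpa [hc k] using this
  · intro j _ hj
    simp [Pi.single_eq_of_ne hj]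
  · simp

theorem mul_eq_zero_of_basis {ι : Type*} [Fintype ι] (g : Basis ι K N) (v : N)
    (h : ∀ i, v * g i = 0) (y : N) : v * y = 0 := by
  rw [← g.sum_repr y, Finset.mul_sum]
  exact Finset.sum_eq_zero fun i _ => by rw [mul_smul_comm, h, smul_zero]

/-- Replacing the first layer of a basis by another family. -/
theorem exists_basis_replace_inl {ι κ ι' V : Type*} [Fintype ι] [Fintype κ] [AddCommGroup V]
    [Module K V] (g : Basis (ι ⊕ κ) K V) (f : Basis ι' K (ι → K)) :
    ∃ g' : Basis (ι' ⊕ κ) K V, (∀ i, g' (.inl i) = ∑ k, f i k • g (.inl k)) ∧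
      ∀ j, g' (.inr j) = g (.inr j) := by
  classical
  refine ⟨(f.prod (Pi.basisFun K κ)).map
    (g.equivFun.trans (LinearEquiv.sumArrowLequivProdArrow ι κ K K)).symm, fun i => ?_,
    fun j => ?_⟩
  · simp [Basis.equivFun_symm_apply, Fintype.sum_sum_type]
  · simp [Basis.equivFun_symm_apply, Fintype.sum_sum_type, Pi.single_apply]

/-- The middle layer is re-based so that the first third-layer square has component f₀ + f₁. Then α
0 times v is absorbed into f₀ and v is rescaled by the norm Q of f₀. Neither spoils naturality,
since v annihilates everything. -/
theorem exists_isNormalBasis {n : ℕ} {e : Basis (Fin n) K N} (h2 : (2 : K) ≠ 0)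
    (he : IsNaturalBasis e) (hnil : IsNilAlgebra N) (hpa : IsPowerAssociative N)
    (hna : ¬ IsAssociative N) (hann : finrank K (algebraAnnihilator K N) = 1)
    (hdim : finrank K N ≤ 6) :
    ∃ (m q : ℕ) (g : Basis ((Fin 2 ⊕ Fin m) ⊕ Fin (q + 1) ⊕ Unit) K N) (c : Fin m → K)
      (b α : Fin q → K), IsNormalBasis g c b α ∧ m + q ≤ 2 := by
  obtain ⟨p, q', g, c, a, α, hnat, hzz, hA, hB, hW, hq⟩ :=
    he.exists_layered_basis h2 hnil hpa hna hann
  obtain ⟨q, rfl⟩ := Nat.exists_eq_succ_of_ne_zero hq.ne'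
  set v := g (.inr (.inr ())) with hv
  have hvy : ∀ y, v * y = 0 := mul_eq_zero_of_basis g v fun i => by
    by_cases hi : i = .inr (.inr ())
    · rw [hi, hzz]
    · exact hnat _ _ (Ne.symm hi)
  have hyv : ∀ y, y * v = 0 := fun y => by rw [mul_comm, hvy]
  set B := diagonalForm c with hBdef
  have hBapp : ∀ x y, B x y = ∑ k, x k * y k * c k := diagonalForm_apply c
  obtain ⟨m, f, hort, hne, hf, hopp⟩ := exists_orthogonal_basis_of_isotropic h2 B
    (diagonalForm_isSymm c) (eq_zero_of_diagonalForm_eq_zero fun k => (hA k).1) (a 0) (hB 0).1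
    (hW 0 0)
  obtain ⟨g1, g1l, g1r⟩ := exists_basis_replace_inl g f
  set Q := B (f (.inl 0)) (f (.inl 0)) with hQ
  have hQ0 : Q ≠ 0 := hne _
  have hmq : m + q ≤ 2 := by
    have := Module.finrank_eq_card_basis g1
    simp at this
    omega
  have hslope : ∀ i, ∃ b : K, a i = b • a 0 := by
    intro i
    by_cases hm : m ≤ 1
    · obtain ⟨b, hb⟩ := eq_smul_of_isotropic B hm f hort hne hopp (a i) (by rw [hf]; exact hW 0 i)
        (hW i i)
      exact ⟨b, by rw [hb, hf]⟩
    -- Here m ≥ 2 forces q = 0, so there is only one third-layer vector.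
    · have : Subsingleton (Fin q.succ) := Fin.subsingleton_iff_le_one.2 (by omega)
      exact ⟨1, by rw [Subsingleton.elim i 0, one_smul]⟩
  choose b hb using hslope
  have hJJ : ∀ x y : Fin p → K,
      (∑ k, x k • g (.inl k)) * (∑ k, y k • g (.inl k)) = B x y • v := fun x y => by
    rw [Finset.sum_mul, hBapp, Finset.sum_smul]
    refine Finset.sum_congr rfl fun k _ => ?_
    rw [Finset.mul_sum, Finset.sum_eq_single k]
    · rw [smul_mul_smul_comm, (hA k).2, smul_smul]
    · intro l _ hl
      rw [smul_mul_smul_comm, hnat _ _ (by simpa using hl.symm), smul_zero]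
    · simp
  have hJr : ∀ (x : Fin p → K) j, (∑ k, x k • g (.inl k)) * g (.inr j) = 0 := fun x j => by
    rw [Finset.sum_mul]
    exact Finset.sum_eq_zero fun k _ => by rw [smul_mul_assoc, hnat _ _ (by simp), smul_zero]
  have hnat1 : ∀ i j, i ≠ j → g1 i * g1 j = 0 := by
    rintro (i | i) (j | j) hij
    · rw [g1l, g1l, hJJ, hort _ _ (by simpa using hij), zero_smul]
    · rw [g1l, g1r, hJr]
    · rw [g1l, g1r, mul_comm, hJr]
    · rw [g1r, g1r, hnat _ _ fun h => hij (congrArg Sum.inr (Sum.inr.inj h))]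
  classical
  obtain ⟨g2, hg2⟩ := exists_basis_smul_add_smul g1 (.inr (.inr ()))
    (Function.update (fun _ => 1) (.inr (.inr ())) Q) (Pi.single (.inl (.inl 0)) (α 0))
    (fun i => by
      by_cases hi : i = .inr (.inr ())
      · rw [hi, Function.update_self]; exact hQ0
      · rw [Function.update_of_ne hi]; exact one_ne_zero)
    (Pi.single_eq_of_ne (by simp) _)
  rw [g1r, ← hv] at hg2
  have k0 : g2 (.inl (.inl 0)) = g1 (.inl (.inl 0)) + α 0 • v := by simp [hg2]
  have k1 : g2 (.inl (.inl 1)) = g1 (.inl (.inl 1)) := by simp [hg2]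
  have kA : ∀ i, g2 (.inl (.inr i)) = g1 (.inl (.inr i)) := fun i => by simp [hg2]
  have kB : ∀ i, g2 (.inr (.inl i)) = g (.inr (.inl i)) := fun i => by simp [hg2, g1r]
  have kv : g2 (.inr (.inr ())) = Q • v := by simp [hg2, g1r, ← hv]
  have hsum : g2 (.inl (.inl 0)) + g2 (.inl (.inl 1)) =
      (∑ k, a 0 k • g (.inl k)) + α 0 • v := by
    rw [k0, k1, g1l, g1l, add_right_comm, ← Finset.sum_add_distrib, ← hf]
    simp only [← add_smul, Pi.add_apply]
  refine ⟨m, q, g2, fun i => B (f (.inr i)) (f (.inr i)) / Q, fun i => b i.succ,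
    -- Subtracting b times the first square, which contains α 0 • v, leaves this coefficient of the
    -- rescaled vector Q • v.
    fun i => (α i.succ - b i.succ * α 0) / Q, ?_, hmq⟩
  refine ⟨fun i j hij => ?_, ?_, ?_, ?_, fun i => div_ne_zero (hne _) hQ0, fun i => ?_, ?_,
    fun i h => ?_, fun i => ?_⟩
  · simp only [hg2, add_mul, mul_add, smul_mul_assoc, mul_smul_comm, hvy, hyv, hnat1 i j hij,
      smul_zero, add_zero]
  · rw [kv, smul_mul_assoc, hvy, smul_zero]
  · simp only [k0, kv, add_mul, mul_add, smul_mul_assoc, mul_smul_comm, hvy, hyv, smul_zero,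
      add_zero, g1l, hJJ, hQ]
  · rw [k1, kv, g1l, hJJ, hopp, neg_smul]
  · rw [kA, kv, g1l, hJJ, smul_smul, div_mul_cancel₀ _ hQ0]
  · rw [hsum, kB, (hB 0).2]
  · exact (hB i.succ).1 (by rw [hb i.succ, show b i.succ = 0 from h, zero_smul])
  · have : ∑ k, a i.succ k • g (.inl k) = b i.succ • ∑ k, a 0 k • g (.inl k) := by
      rw [Finset.smul_sum]
      refine Finset.sum_congr rfl fun k _ => ?_
      rw [smul_smul, hb i.succ]
      rfl
    rw [hsum, kB, kv, (hB i.succ).2, this, smul_smul, div_mul_cancel₀ _ hQ0]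
    module

end NormalForm

/-! ### Matching the normal form with the tables -/

section Classification

variable {K : Type*} [Field K] {N : Type*} [NonUnitalNonAssocCommRing N] [Module K N]
  [IsScalarTower K N N] [SMulCommClass K N N]

theorem exists_basis_reindex {ι : Type*} {n : ℕ} (g : Basis ι K N) (t : Fin n → ι)
    (ht : Function.Bijective t) (hg : ∀ i j, i ≠ j → g i * g j = 0) :
    ∃ e : Basis (Fin n) K N, IsNaturalBasis e ∧ ∀ i, e i = g (t i) := by
  have h : ∀ i, g.reindex (Equiv.ofBijective t ht).symm i = g (t i) := fun i => by simp
  exact ⟨_, fun i j hij => by rw [h, h, hg _ _ (ht.1.ne hij)], h⟩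

/-- In dimension six, two further squares in the span of `e₂ + e₃` and `e₆`, not in `K e₆`. -/
theorem classification_of_two_slopes {α β γ δ : K} {e : Basis (Fin 6) K N}
    (he : IsNaturalBasis e) (hα : α ≠ 0) (hγ : γ ≠ 0) (h0 : e 0 * e 0 = e 1 + e 2)
    (h1 : e 1 * e 1 = e 5) (h2 : e 2 * e 2 = -e 5) (h3 : e 3 * e 3 = α • (e 1 + e 2) + β • e 5)
    (h4 : e 4 * e 4 = γ • (e 1 + e 2) + δ • e 5) (h5 : e 5 * e 5 = 0) :
    (∃ (α β : K) (e : Basis (Fin 6) K N), IsN622 α β e) ∨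
    (∃ (α β γ δ : K) (e : Basis (Fin 6) K N), IsN623 α β γ δ e) ∨
    (∃ (α β γ : K) (e : Basis (Fin 6) K N), IsN624 α β γ e) := by
  by_cases hβ : β = 0
  · by_cases hδ : δ = 0
    · exact Or.inl ⟨α, γ, e, hα, hγ, he, h0, h1, h2, by rw [h3, hβ, zero_smul, add_zero],
        by rw [h4, hδ, zero_smul, add_zero], h5⟩
    -- Exchanging the two extra vectors puts the one with nonzero `e 5`-component first.
    · obtain ⟨f, hf, hfe⟩ := exists_basis_reindex e ![0, 1, 2, 4, 3, 5] (by decide) he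
      refine Or.inr (Or.inr ⟨γ, δ, α, f, mul_ne_zero (mul_ne_zero hγ hδ) hα, hf, ?_⟩)
      simp [hfe, h0, h1, h2, h3, h4, h5, hβ]
  by_cases hδ : δ = 0
  · exact Or.inr (Or.inr ⟨α, β, γ, e, mul_ne_zero (mul_ne_zero hα hβ) hγ, he, h0, h1, h2, h3,
      by rw [h4, hδ, zero_smul, add_zero], h5⟩)
  by_cases hdet : α * δ - β * γ = 0
  · have hv : ∀ y, e 5 * y = 0 := mul_eq_zero_of_basis e (e 5) fun i => by
      by_cases hi : i = 5
      · rw [hi, h5]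
      · exact he _ _ (Ne.symm hi)
    have hv' : ∀ y, y * e 5 = 0 := fun y => by rw [mul_comm, hv]
    -- The squares of `e 3` and `e 4` are proportional here, so `e 3` takes over the role of `e 0`:
    -- its square α(e 1 + e 2) + βe 5 becomes the new sum of second and third vectors. These have
    -- squares ±α² • e 5, hence the last scale factor. The old `e 0` becomes the extra vector with a
    -- nonzero last component, and the algebra is of type `IsN624`.
    obtain ⟨g, hg⟩ := exists_basis_smul_add_smul e 5 ![1, α, α, 1, 1, α ^ 2] ![0, β, 0, 0, 0, 0]
      (fun i => by fin_cases i <;> simp [hα]) rfl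
    have hgnat : ∀ i j, i ≠ j → g i * g j = 0 := fun i j hij => by
      simp only [hg, add_mul, mul_add, smul_mul_assoc, mul_smul_comm, hv, hv', he i j hij,
        smul_zero, add_zero]
    obtain ⟨f, hf, hfg⟩ := exists_basis_reindex g ![3, 1, 2, 0, 4, 5] (by decide) hgnat
    have f0 : f 0 = e 3 := by simp [hfg, hg]
    have f1 : f 1 = α • e 1 + β • e 5 := by simp [hfg, hg]
    have f2 : f 2 = α • e 2 := by simp [hfg, hg]
    have f3 : f 3 = e 0 := by simp [hfg, hg]
    have f4 : f 4 = e 4 := by simp [hfg, hg]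
    have f5 : f 5 = α ^ 2 • e 5 := by simp [hfg, hg]
    have hδ' : δ = γ / α * β := by
      field_simp
      linear_combination hdet
    refine Or.inr (Or.inr ⟨α⁻¹, -(β / α ^ 3), γ / α, f, ?_, hf, ?_, ?_, ?_, ?_, ?_, ?_⟩)
    · exact mul_ne_zero (mul_ne_zero (inv_ne_zero hα)
        (neg_ne_zero.2 (div_ne_zero hβ (pow_ne_zero _ hα)))) (div_ne_zero hγ hα)
    · rw [f0, f1, f2, h3]
      module
    · rw [f1, f5]
      simp only [add_mul, mul_add, smul_mul_assoc, mul_smul_comm, hv, hv', h1, smul_zero, add_zero]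
      module
    · rw [f2, f5]
      simp only [smul_mul_assoc, mul_smul_comm, h2]
      module
    · rw [f3, f1, f2, f5, h0]
      match_scalars <;> field_simp
      ring
    · rw [f4, f1, f2, h4, hδ']
      match_scalars <;> field_simp
    · rw [f5, smul_mul_assoc, hv, smul_zero]
  · exact Or.inr (Or.inl ⟨α, β, γ, δ, e, hdet, mul_ne_zero hα hγ, mul_ne_zero hβ hδ, he, h0, h1,
      h2, h3, h4, h5⟩)

/-- The pairs (m, q) with m + q ≤ 2 determine the shape: m counts the extra vectors with square in
Kv, q those with square of nonzero slope. When q = 1, the vanishing of α 0 decides between two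
tables. -/
theorem classification {n : ℕ} {e : Basis (Fin n) K N} (h2 : (2 : K) ≠ 0)
    (he : IsNaturalBasis e) (hnil : IsNilAlgebra N) (hpa : IsPowerAssociative N)
    (hna : ¬ IsAssociative N) (hann : finrank K (algebraAnnihilator K N) = 1)
    (hdim : finrank K N ≤ 6) :
    (∃ e : Basis (Fin 4) K N, IsN46 e) ∨
    (∃ (α : K) (e : Basis (Fin 5) K N), IsN510 α e) ∨
    (∃ (α : K) (e : Basis (Fin 5) K N), IsN511 α e) ∨
    (∃ (α β : K) (e : Basis (Fin 5) K N), IsN512 α β e) ∨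
    (∃ (α β : K) (e : Basis (Fin 6) K N), IsN619 α β e) ∨
    (∃ (α β : K) (e : Basis (Fin 6) K N), IsN620 α β e) ∨
    (∃ (α β γ : K) (e : Basis (Fin 6) K N), IsN621 α β γ e) ∨
    (∃ (α β : K) (e : Basis (Fin 6) K N), IsN622 α β e) ∨
    (∃ (α β γ δ : K) (e : Basis (Fin 6) K N), IsN623 α β γ δ e) ∨
    (∃ (α β γ : K) (e : Basis (Fin 6) K N), IsN624 α β γ e) := by
  obtain ⟨m, q, g, c, b, α, hg, hmq⟩ := exists_isNormalBasis h2 he hnil hpa hna hann hdim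
  obtain ⟨hnat, hv, h0, h1, hc, hl, hf, hb, hs⟩ := hg
  have hm : m ≤ 2 := by omega
  interval_cases m
  · have hq : q ≤ 2 := by omega
    interval_cases q
    · obtain ⟨f, hfn, hfg⟩ := exists_basis_reindex g
        ![.inr (.inl 0), .inl (.inl 0), .inl (.inl 1), .inr (.inr ())] (by decide) hnat
      exact Or.inl ⟨f, hfn, by simp [hfg, hf, h0, h1, hv]⟩
    · obtain ⟨f, hfn, hfg⟩ := exists_basis_reindex g
        ![.inr (.inl 0), .inl (.inl 0), .inl (.inl 1), .inr (.inl 1), .inr (.inr ())]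
        (by decide) hnat
      have hs0 := hs 0
      rw [show Fin.succ (0 : Fin 1) = 1 from rfl] at hs0
      by_cases hα : α 0 = 0
      · rw [hα, zero_smul, add_zero] at hs0
        exact Or.inr (Or.inr (Or.inl ⟨b 0, f, hb 0, hfn, by simp [hfg, hf, h0, h1, hv, hs0]⟩))
      · exact Or.inr (Or.inr (Or.inr (Or.inl ⟨b 0, α 0, f, hb 0, hα, hfn, by
          simp [hfg, hf, h0, h1, hv, hs0]⟩)))
    · obtain ⟨f, hfn, hfg⟩ := exists_basis_reindex g
        ![.inr (.inl 0), .inl (.inl 0), .inl (.inl 1), .inr (.inl 1), .inr (.inl 2), .inr (.inr ())]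
        (by decide) hnat
      have hs0 := hs 0
      have hs1 := hs 1
      rw [show Fin.succ (0 : Fin 2) = 1 from rfl] at hs0
      rw [show Fin.succ (1 : Fin 2) = 2 from rfl] at hs1
      have := classification_of_two_slopes (α := b 0) (β := α 0) (γ := b 1) (δ := α 1) hfn (hb 0)
        (hb 1) (by simp [hfg, hf]) (by simp [hfg, h0]) (by simp [hfg, h1]) (by simp [hfg, hs0])
        (by simp [hfg, hs1]) (by simp [hfg, hv])
      exact Or.inr (Or.inr (Or.inr (Or.inr (Or.inr (Or.inr (Or.inr this))))))
  · have hq : q ≤ 1 := by omega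
    interval_cases q
    · obtain ⟨f, hfn, hfg⟩ := exists_basis_reindex g
        ![.inr (.inl 0), .inl (.inl 0), .inl (.inl 1), .inl (.inr 0), .inr (.inr ())]
        (by decide) hnat
      exact Or.inr (Or.inl ⟨c 0, f, hc 0, hfn, by simp [hfg, hf, h0, h1, hv, hl]⟩)
    · obtain ⟨f, hfn, hfg⟩ := exists_basis_reindex g
        ![.inr (.inl 0), .inl (.inl 0), .inl (.inl 1), .inr (.inl 1), .inl (.inr 0), .inr (.inr ())]
        (by decide) hnat
      have hs0 := hs 0
      rw [show Fin.succ (0 : Fin 1) = 1 from rfl] at hs0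
      by_cases hα : α 0 = 0
      · rw [hα, zero_smul, add_zero] at hs0
        exact Or.inr (Or.inr (Or.inr (Or.inr (Or.inr (Or.inl ⟨b 0, c 0, f, hb 0, hc 0, hfn, by
          simp [hfg, hf, h0, h1, hv, hs0, hl]⟩)))))
      · exact Or.inr (Or.inr (Or.inr (Or.inr (Or.inr (Or.inr (Or.inl ⟨b 0, α 0, c 0, f, hb 0, hα,
          hc 0, hfn, by simp [hfg, hf, h0, h1, hv, hs0, hl]⟩))))))
  · obtain rfl : q = 0 := by omega
    obtain ⟨f, hfn, hfg⟩ := exists_basis_reindex g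
      ![.inr (.inl 0), .inl (.inl 0), .inl (.inl 1), .inl (.inr 0), .inl (.inr 1), .inr (.inr ())]
      (by decide) hnat
    exact Or.inr (Or.inr (Or.inr (Or.inr (Or.inl ⟨c 0, c 1, f, hc 0, hc 1, hfn, by
      simp [hfg, hf, h0, h1, hv, hl]⟩))))

end Classification

/-! ### Derivations as solutions of a linear system -/

section Derivations

variable {K : Type*} [Field K] {N : Type*} [NonUnitalNonAssocCommRing N] [Module K N]
  [IsScalarTower K N N] [SMulCommClass K N N] {n : ℕ} {e : Basis (Fin n) K N}

theorem mem_derivations_iff_basis {ι : Type*} (e : Basis ι K N) (d : Module.End K N) :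
    d ∈ derivations K N ↔ ∀ i j, d (e i * e j) = e i * d (e j) + d (e i) * e j := by
  refine ⟨fun h i j => h _ _, fun h => ?_⟩
  have : (LinearMap.mul K N).compr₂ d = (LinearMap.mul K N).compl₂ d + (LinearMap.mul K N).comp d :=
    e.ext fun i => e.ext fun j => by simpa using h i j
  intro u v
  simpa using LinearMap.congr_fun (LinearMap.congr_fun this u) v

/-- The linear equations defining derivations in coordinates of a natural basis. -/
theorem IsNaturalBasis.mem_derivations_iff (he : IsNaturalBasis e) (a : Fin n → Fin n → K)
    (ha : ∀ i, e i * e i = ∑ k, a i k • e k) (d : Module.End K N) :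
    d ∈ derivations K N ↔
      (∀ i k, ∑ j, a i j * e.repr (d (e j)) k = 2 * e.repr (d (e i)) i * a i k) ∧
      ∀ i j, i < j → ∀ k,
        e.repr (d (e j)) i * a i k + e.repr (d (e i)) j * a j k = 0 := by
  have hrepr : ∀ i k, e.repr (e i * e i) k = a i k := fun i k => by
    rw [ha, e.repr_sum_self]
  have hr : ∀ i x, e i * x = e.repr x i • (e i * e i) := fun i x => by
    rw [mul_comm, he.mul_basis]
  have hdiag : ∀ i, d (e i * e i) = e i * d (e i) + d (e i) * e i ↔
      ∀ k, ∑ j, a i j * e.repr (d (e j)) k = 2 * e.repr (d (e i)) i * a i k := fun i => by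
    rw [← e.repr.injective.eq_iff, Finsupp.ext_iff]
    refine forall_congr' fun k => ?_
    rw [he.mul_basis (d (e i)), hr i (d (e i)), map_add, Finsupp.add_apply, map_smul, Finsupp.smul_apply, hrepr,
      smul_eq_mul, ← two_mul, ← mul_assoc]
    simp [ha]
  have hoff : ∀ i j, i ≠ j → (d (e i * e j) = e i * d (e j) + d (e i) * e j ↔
      ∀ k, e.repr (d (e j)) i * a i k + e.repr (d (e i)) j * a j k = 0) := fun i j hij => by
    rw [he i j hij, map_zero, eq_comm, ← e.repr.injective.eq_iff, Finsupp.ext_iff]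
    refine forall_congr' fun k => ?_
    rw [he.mul_basis (d (e i)), hr i (d (e j)), map_add, Finsupp.add_apply, map_smul, map_smul,
      Finsupp.smul_apply, Finsupp.smul_apply, hrepr, hrepr]
    simp
  rw [mem_derivations_iff_basis e]
  constructor
  · exact fun h => ⟨fun i => (hdiag i).1 (h i i), fun i j hij => (hoff i j hij.ne).1 (h i j)⟩
  · rintro ⟨h1, h2⟩ i j
    rcases lt_trichotomy i j with hij | rfl | hij
    · exact (hoff i j hij.ne).2 (h2 i j hij)
    · exact (hdiag i).2 (h1 i)
    · rw [mul_comm (e i) (e j), (hoff j i hij.ne).2 (h2 j i hij), add_comm, mul_comm (d (e j)),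
        mul_comm (e j)]

/-- A space of endomorphisms parametrised by some of the matrix entries. -/
theorem nonempty_linearEquiv_of_entries {V : Type*} [AddCommGroup V] [Module K V] {n r s : ℕ}
    (e : Basis (Fin n) K V) (D : Submodule K (Module.End K V)) (P : (Fin (r + s) → K) → Fin n → V)
    (pos : Fin (r + s) → Fin n × Fin n)
    (hpos : ∀ x t, e.repr (P x (pos t).2) (pos t).1 = x t)
    (hP : ∀ d : Module.End K V, d ∈ D ↔ ∃ x, ∀ j, d (e j) = P x j) :
    Nonempty (D ≃ₗ[K] (Fin r → K) × (Fin s → K)) := by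
  let L : D →ₗ[K] (Fin (r + s) → K) :=
    LinearMap.pi fun t => e.coord (pos t).1 ∘ₗ LinearMap.applyₗ (e (pos t).2) ∘ₗ D.subtype
  have hL : ∀ (d : D) x, (∀ j, d.1 (e j) = P x j) → L d = x := fun d x h => by
    ext t
    rw [← hpos x t, ← h]
    rfl
  have hbij : Function.Bijective L := by
    constructor
    · intro d d' h
      obtain ⟨x, hx⟩ := (hP d).1 d.2
      obtain ⟨x', hx'⟩ := (hP d').1 d'.2
      have : x = x' := by rw [← hL d x hx, ← hL d' x' hx', h]
      exact Subtype.ext (e.ext fun j => by rw [hx, hx', this])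
    · intro x
      have h : ∀ j, e.constr K (P x) (e j) = P x j := e.constr_basis K _
      exact ⟨⟨e.constr K (P x), (hP _).2 ⟨x, h⟩⟩, hL _ x h⟩
  -- Only the total dimension r + s is used. In the tables the last s parameters are the free
  -- coordinates along the annihilating basis vector.
  exact ⟨(LinearEquiv.ofBijective L hbij).trans
    (LinearEquiv.ofFinrankEq _ _ (by simp))⟩

/-- The derivations of an algebra with a natural basis, parametrised by some matrix entries in terms
of which the equations for derivations express all matrix entries. -/
theorem IsNaturalBasis.derivations_of_entries (he : IsNaturalBasis e) (a : Fin n → Fin n → K)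
    (ha : ∀ i, e i * e i = ∑ k, a i k • e k) {r s : ℕ} (P : (Fin (r + s) → K) → Fin n → Fin n → K)
    (pos : Fin (r + s) → Fin n × Fin n) (hpos : ∀ x t, P x (pos t).2 (pos t).1 = x t)
    (h : ∀ c : Fin n → Fin n → K,
      ((∀ i k, ∑ j, a i j * c j k = 2 * c i i * a i k) ∧
        ∀ i j, i < j → ∀ k, c j i * a i k + c i j * a j k = 0) ↔
      ∀ j k, c j k = P (fun t => c (pos t).2 (pos t).1) j k) :
    (∀ d : Module.End K N, d ∈ derivations K N ↔ ∃ x, ∀ j, d (e j) = ∑ k, P x j k • e k) ∧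
      Nonempty (derivations K N ≃ₗ[K] (Fin r → K) × (Fin s → K)) := by
  have hd : ∀ d : Module.End K N,
      d ∈ derivations K N ↔ ∃ x, ∀ j, d (e j) = ∑ k, P x j k • e k := fun d => by
    have hc : ∀ x, (∀ j, d (e j) = ∑ k, P x j k • e k) ↔
        ∀ j k, e.repr (d (e j)) k = P x j k := fun x => by
      refine forall_congr' fun j => ⟨fun hj k => by rw [hj, e.repr_sum_self], fun hj => ?_⟩
      rw [← e.sum_repr (d (e j))]
      simp only [hj]
    simp only [hc]
    rw [he.mem_derivations_iff a ha, h fun j k => e.repr (d (e j)) k]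
    refine ⟨fun hx => ⟨_, hx⟩, fun ⟨x, hx⟩ => ?_⟩
    have : (fun t => e.repr (d (e (pos t).2)) (pos t).1) = x :=
      funext fun t => by rw [hx, hpos]
    rwa [this]
  exact ⟨hd, nonempty_linearEquiv_of_entries e _ (fun x j => ∑ k, P x j k • e k) pos
    (fun x t => by rw [e.repr_sum_self, hpos]) hd⟩

end Derivations

/-! ### Derivations of the ten families -/

section DerivationTables

variable {K : Type*} [Field K] {N : Type*} [NonUnitalNonAssocCommRing N] [Module K N]
  [IsScalarTower K N N] [SMulCommClass K N N]

set_option maxHeartbeats 1000000 in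
-- Opposite squares make the mixed entries of `e 1` and `e 2` equal, and d(e 1 + e 2) = 2 d11 (e 1 +
-- e 2) then fixes the block. This pattern recurs in all the tables.
theorem derivations_N46 (e : Basis (Fin 4) K N) (he : IsN46 e) :
    (∀ d : Module.End K N, d ∈ derivations K N ↔
        ∃ d11 d22 d41 d42 : K,
          d (e 0) = d11 • e 0 + d41 • e 3 ∧
          d (e 1) = d22 • e 1 + (2 * d11 - d22) • e 2 + d42 • e 3 ∧
          d (e 2) = (2 * d11 - d22) • e 1 + d22 • e 2 - d42 • e 3 ∧
          d (e 3) = (2 * d22) • e 3) ∧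
    Nonempty (derivations K N ≃ₗ[K] (Fin 2 → K) × (Fin 2 → K)) := by
  obtain ⟨hn, s0, s1, s2, s3⟩ := he
  obtain ⟨hd, hD⟩ := hn.derivations_of_entries (r := 2) (s := 2)
    -- Row i holds the coordinates of (e i)²; row j of the next matrix holds those of d (e j).
    ![![0, 1, 1, 0], ![0, 0, 0, 1], ![0, 0, 0, -1], 0]
    (by simp [Fin.forall_fin_succ, Fin.sum_univ_succ, s0, s1, s2, s3])
    (fun x => ![
      ![x 0, 0, 0, x 2],
      ![0, x 1, 2 * x 0 - x 1, x 3],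
      ![0, 2 * x 0 - x 1, x 1, -x 3],
      ![0, 0, 0, 2 * x 1]])
    -- A pair (k, j) marks the coordinate of d (e j) along e k, so the free entries are d11, d22,
    -- d41, d42.
    ![(0, 0), (1, 1), (3, 0), (3, 1)]
    (by simp [Fin.forall_fin_succ]) (fun c => by
      clear s0 s1 s2 s3 hn e
      simp [Fin.forall_fin_succ, Fin.sum_univ_succ]
      constructor <;> intro h <;> grind (splits := 60))
  refine ⟨fun d => (hd d).trans ⟨?_, ?_⟩, hD⟩
  · rintro ⟨x, h⟩
    refine ⟨x 0, x 1, x 2, x 3, ?_⟩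
    simpa [Fin.forall_fin_succ, Fin.sum_univ_succ, sub_eq_add_neg, add_assoc] using h
  · rintro ⟨d11, d22, d41, d42, h⟩
    refine ⟨![d11, d22, d41, d42], ?_⟩
    simpa [Fin.forall_fin_succ, Fin.sum_univ_succ, sub_eq_add_neg, add_assoc] using h

set_option maxHeartbeats 1000000 in
-- The square of `e 3` lies on the line of those of `e 1` and `e 2`, which leaves the mixing
-- parameter d42; cancelling 2α gives `e 3` the diagonal entry d22.
theorem derivations_N510 (h2 : (2 : K) ≠ 0) (α : K) (e : Basis (Fin 5) K N) (he : IsN510 α e) :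
    (∀ d : Module.End K N, d ∈ derivations K N ↔
        ∃ d11 d22 d42 d51 d52 d54 : K,
          d (e 0) = d11 • e 0 + d51 • e 4 ∧
          d (e 1) = d22 • e 1 + (2 * d11 - d22) • e 2 + d42 • e 3 + d52 • e 4 ∧
          d (e 2) = (2 * d11 - d22) • e 1 + d22 • e 2 - d42 • e 3 - d52 • e 4 ∧
          d (e 3) = (-(α * d42)) • e 1 - (α * d42) • e 2 + d22 • e 3 + d54 • e 4 ∧
          d (e 4) = (2 * d22) • e 4) ∧
    Nonempty (derivations K N ≃ₗ[K] (Fin 3 → K) × (Fin 3 → K)) := by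
  obtain ⟨hα, hn, s0, s1, s2, s3, s4⟩ := he
  obtain ⟨hd, hD⟩ := hn.derivations_of_entries (r := 3) (s := 3)
    ![![0, 1, 1, 0, 0], ![0, 0, 0, 0, 1], ![0, 0, 0, 0, -1], ![0, 0, 0, 0, α], 0]
    (by simp [Fin.forall_fin_succ, Fin.sum_univ_succ, s0, s1, s2, s3, s4])
    (fun x => ![
      ![x 0, 0, 0, 0, x 3],
      ![0, x 1, 2 * x 0 - x 1, x 2, x 4],
      ![0, 2 * x 0 - x 1, x 1, -x 2, -x 4],
      ![0, -(α * x 2), -(α * x 2), x 1, x 5],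
      ![0, 0, 0, 0, 2 * x 1]])
    ![(0, 0), (1, 1), (3, 1), (4, 0), (4, 1), (4, 3)]
    (by simp [Fin.forall_fin_succ]) (fun c => by
      clear s0 s1 s2 s3 s4 hn e
      simp [Fin.forall_fin_succ, Fin.sum_univ_succ, hα]
      constructor <;> intro h <;> grind (splits := 60))
  refine ⟨fun d => (hd d).trans ⟨?_, ?_⟩, hD⟩
  · rintro ⟨x, h⟩
    refine ⟨x 0, x 1, x 2, x 3, x 4, x 5, ?_⟩
    simpa [Fin.forall_fin_succ, Fin.sum_univ_succ, sub_eq_add_neg, add_assoc] using h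
  · rintro ⟨d11, d22, d42, d51, d52, d54, h⟩
    refine ⟨![d11, d22, d42, d51, d52, d54], ?_⟩
    simpa [Fin.forall_fin_succ, Fin.sum_univ_succ, sub_eq_add_neg, add_assoc] using h

set_option maxHeartbeats 1000000 in
theorem derivations_N511 (h2 : (2 : K) ≠ 0) (α : K) (e : Basis (Fin 5) K N) (he : IsN511 α e) :
    (∀ d : Module.End K N, d ∈ derivations K N ↔
        ∃ d11 d22 d41 d51 d52 d54 : K,
          d (e 0) = d11 • e 0 + d41 • e 3 + d51 • e 4 ∧
          d (e 1) = d22 • e 1 + (2 * d11 - d22) • e 2 + d52 • e 4 ∧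
          d (e 2) = (2 * d11 - d22) • e 1 + d22 • e 2 - d52 • e 4 ∧
          d (e 3) = (-(α * d41)) • e 0 + d11 • e 3 + d54 • e 4 ∧
          d (e 4) = (2 * d22) • e 4) ∧
    Nonempty (derivations K N ≃ₗ[K] (Fin 3 → K) × (Fin 3 → K)) := by
  obtain ⟨hα, hn, s0, s1, s2, s3, s4⟩ := he
  obtain ⟨hd, hD⟩ := hn.derivations_of_entries (r := 3) (s := 3)
    ![![0, 1, 1, 0, 0], ![0, 0, 0, 0, 1], ![0, 0, 0, 0, -1], ![0, α, α, 0, 0], 0]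
    (by simp [Fin.forall_fin_succ, Fin.sum_univ_succ, s0, s1, s2, s3, s4])
    (fun x => ![
      ![x 0, 0, 0, x 2, x 3],
      ![0, x 1, 2 * x 0 - x 1, 0, x 4],
      ![0, 2 * x 0 - x 1, x 1, 0, -x 4],
      ![-(α * x 2), 0, 0, x 0, x 5],
      ![0, 0, 0, 0, 2 * x 1]])
    ![(0, 0), (1, 1), (3, 0), (4, 0), (4, 1), (4, 3)]
    (by simp [Fin.forall_fin_succ]) (fun c => by
      clear s0 s1 s2 s3 s4 hn e
      simp [Fin.forall_fin_succ, Fin.sum_univ_succ, hα]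
      constructor <;> intro h <;> grind (splits := 60))
  refine ⟨fun d => (hd d).trans ⟨?_, ?_⟩, hD⟩
  · rintro ⟨x, h⟩
    refine ⟨x 0, x 1, x 2, x 3, x 4, x 5, ?_⟩
    simpa [Fin.forall_fin_succ, Fin.sum_univ_succ, sub_eq_add_neg, add_assoc] using h
  · rintro ⟨d11, d22, d41, d51, d52, d54, h⟩
    refine ⟨![d11, d22, d41, d51, d52, d54], ?_⟩
    simpa [Fin.forall_fin_succ, Fin.sum_univ_succ, sub_eq_add_neg, add_assoc] using h

set_option maxHeartbeats 1000000 in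
-- Since (e 3)² has nonzero components along both (e 0)² and (e 1)², its diagonal entry equals both
-- d11 and d22, and it mixes with neither vector.
theorem derivations_N512 (h2 : (2 : K) ≠ 0) (α β : K) (e : Basis (Fin 5) K N) (he : IsN512 α β e) :
    (∀ d : Module.End K N, d ∈ derivations K N ↔
        ∃ d11 d51 d52 d54 : K,
          d (e 0) = d11 • e 0 + d51 • e 4 ∧
          d (e 1) = d11 • e 1 + d11 • e 2 + d52 • e 4 ∧
          d (e 2) = d11 • e 1 + d11 • e 2 - d52 • e 4 ∧
          d (e 3) = d11 • e 3 + d54 • e 4 ∧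
          d (e 4) = (2 * d11) • e 4) ∧
    Nonempty (derivations K N ≃ₗ[K] (Fin 1 → K) × (Fin 3 → K)) := by
  obtain ⟨hα, hβ, hn, s0, s1, s2, s3, s4⟩ := he
  obtain ⟨hd, hD⟩ := hn.derivations_of_entries (r := 1) (s := 3)
    ![![0, 1, 1, 0, 0], ![0, 0, 0, 0, 1], ![0, 0, 0, 0, -1], ![0, α, α, 0, β], 0]
    (by simp [Fin.forall_fin_succ, Fin.sum_univ_succ, add_assoc, s0, s1, s2, s3, s4])
    (fun x => ![
      ![x 0, 0, 0, 0, x 1],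
      ![0, x 0, x 0, 0, x 2],
      ![0, x 0, x 0, 0, -x 2],
      ![0, 0, 0, x 0, x 3],
      ![0, 0, 0, 0, 2 * x 0]])
    ![(0, 0), (4, 0), (4, 1), (4, 3)]
    (by simp [Fin.forall_fin_succ]) (fun c => by
      clear s0 s1 s2 s3 s4 hn e
      simp [Fin.forall_fin_succ, Fin.sum_univ_succ, hα, hβ]
      constructor <;> intro h <;> grind (splits := 60))
  refine ⟨fun d => (hd d).trans ⟨?_, ?_⟩, hD⟩
  · rintro ⟨x, h⟩
    refine ⟨x 0, x 1, x 2, x 3, ?_⟩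
    simpa [Fin.forall_fin_succ, Fin.sum_univ_succ, sub_eq_add_neg, add_assoc] using h
  · rintro ⟨d11, d51, d52, d54, h⟩
    refine ⟨![d11, d51, d52, d54], ?_⟩
    simpa [Fin.forall_fin_succ, Fin.sum_univ_succ, sub_eq_add_neg, add_assoc] using h

set_option maxHeartbeats 1000000 in
theorem derivations_N619 (h2 : (2 : K) ≠ 0) (α β : K) (e : Basis (Fin 6) K N) (he : IsN619 α β e) :
    (∀ d : Module.End K N, d ∈ derivations K N ↔
        ∃ d11 d22 d42 d52 d54 d61 d62 d64 d65 : K,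
          d (e 0) = d11 • e 0 + d61 • e 5 ∧
          d (e 1) = d22 • e 1 + (2 * d11 - d22) • e 2 + d42 • e 3 + d52 • e 4 + d62 • e 5 ∧
          d (e 2) = (2 * d11 - d22) • e 1 + d22 • e 2 - d42 • e 3 - d52 • e 4 - d62 • e 5 ∧
          d (e 3) = (-(α * d42)) • e 1 - (α * d42) • e 2 + d22 • e 3 + d54 • e 4 + d64 • e 5 ∧
          d (e 4) = (-(β * d52)) • e 1 - (β * d52) • e 2 - (α⁻¹ * β * d54) • e 3 + d22 • e 4 + d65 • e 5 ∧
          d (e 5) = (2 * d22) • e 5) ∧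
    Nonempty (derivations K N ≃ₗ[K] (Fin 5 → K) × (Fin 4 → K)) := by
  obtain ⟨hα, hβ, hn, s0, s1, s2, s3, s4, s5⟩ := he
  obtain ⟨hd, hD⟩ := hn.derivations_of_entries (r := 5) (s := 4)
    ![![0, 1, 1, 0, 0, 0], ![0, 0, 0, 0, 0, 1], ![0, 0, 0, 0, 0, -1], ![0, 0, 0, 0, 0, α], ![0, 0, 0, 0, 0, β], 0]
    (by simp [Fin.forall_fin_succ, Fin.sum_univ_succ, s0, s1, s2, s3, s4, s5])
    (fun x => ![
      ![x 0, 0, 0, 0, 0, x 5],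
      ![0, x 1, 2 * x 0 - x 1, x 2, x 3, x 6],
      ![0, 2 * x 0 - x 1, x 1, -x 2, -x 3, -x 6],
      ![0, -(α * x 2), -(α * x 2), x 1, x 4, x 7],
      ![0, -(β * x 3), -(β * x 3), -(α⁻¹ * β * x 4), x 1, x 8],
      ![0, 0, 0, 0, 0, 2 * x 1]])
    ![(0, 0), (1, 1), (3, 1), (4, 1), (4, 3), (5, 0), (5, 1), (5, 3), (5, 4)]
    (by simp [Fin.forall_fin_succ]) (fun c => by
      clear s0 s1 s2 s3 s4 s5 hn e
      simp [Fin.forall_fin_succ, Fin.sum_univ_succ, hα, hβ]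
      constructor <;> intro h <;> grind (splits := 60))
  refine ⟨fun d => (hd d).trans ⟨?_, ?_⟩, hD⟩
  · rintro ⟨x, h⟩
    refine ⟨x 0, x 1, x 2, x 3, x 4, x 5, x 6, x 7, x 8, ?_⟩
    simpa [Fin.forall_fin_succ, Fin.sum_univ_succ, sub_eq_add_neg, add_assoc] using h
  · rintro ⟨d11, d22, d42, d52, d54, d61, d62, d64, d65, h⟩
    refine ⟨![d11, d22, d42, d52, d54, d61, d62, d64, d65], ?_⟩
    simpa [Fin.forall_fin_succ, Fin.sum_univ_succ, sub_eq_add_neg, add_assoc] using h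

set_option maxHeartbeats 1000000 in
theorem derivations_N620 (h2 : (2 : K) ≠ 0) (α β : K) (e : Basis (Fin 6) K N) (he : IsN620 α β e) :
    (∀ d : Module.End K N, d ∈ derivations K N ↔
        ∃ d11 d22 d41 d52 d61 d62 d64 d65 : K,
          d (e 0) = d11 • e 0 + d41 • e 3 + d61 • e 5 ∧
          d (e 1) = d22 • e 1 + (2 * d11 - d22) • e 2 + d52 • e 4 + d62 • e 5 ∧
          d (e 2) = (2 * d11 - d22) • e 1 + d22 • e 2 - d52 • e 4 - d62 • e 5 ∧
          d (e 3) = (-(α * d41)) • e 0 + d11 • e 3 + d64 • e 5 ∧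
          d (e 4) = (-(β * d52)) • e 1 - (β * d52) • e 2 + d22 • e 4 + d65 • e 5 ∧
          d (e 5) = (2 * d22) • e 5) ∧
    Nonempty (derivations K N ≃ₗ[K] (Fin 4 → K) × (Fin 4 → K)) := by
  obtain ⟨hα, hβ, hn, s0, s1, s2, s3, s4, s5⟩ := he
  obtain ⟨hd, hD⟩ := hn.derivations_of_entries (r := 4) (s := 4)
    ![![0, 1, 1, 0, 0, 0], ![0, 0, 0, 0, 0, 1], ![0, 0, 0, 0, 0, -1], ![0, α, α, 0, 0, 0], ![0, 0, 0, 0, 0, β], 0]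
    (by simp [Fin.forall_fin_succ, Fin.sum_univ_succ, s0, s1, s2, s3, s4, s5])
    (fun x => ![
      ![x 0, 0, 0, x 2, 0, x 4],
      ![0, x 1, 2 * x 0 - x 1, 0, x 3, x 5],
      ![0, 2 * x 0 - x 1, x 1, 0, -x 3, -x 5],
      ![-(α * x 2), 0, 0, x 0, 0, x 6],
      ![0, -(β * x 3), -(β * x 3), 0, x 1, x 7],
      ![0, 0, 0, 0, 0, 2 * x 1]])
    ![(0, 0), (1, 1), (3, 0), (4, 1), (5, 0), (5, 1), (5, 3), (5, 4)]
    (by simp [Fin.forall_fin_succ]) (fun c => by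
      clear s0 s1 s2 s3 s4 s5 hn e
      simp [Fin.forall_fin_succ, Fin.sum_univ_succ, hα, hβ]
      constructor <;> intro h <;> grind (splits := 60))
  refine ⟨fun d => (hd d).trans ⟨?_, ?_⟩, hD⟩
  · rintro ⟨x, h⟩
    refine ⟨x 0, x 1, x 2, x 3, x 4, x 5, x 6, x 7, ?_⟩
    simpa [Fin.forall_fin_succ, Fin.sum_univ_succ, sub_eq_add_neg, add_assoc] using h
  · rintro ⟨d11, d22, d41, d52, d61, d62, d64, d65, h⟩
    refine ⟨![d11, d22, d41, d52, d61, d62, d64, d65], ?_⟩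
    simpa [Fin.forall_fin_succ, Fin.sum_univ_succ, sub_eq_add_neg, add_assoc] using h

set_option maxHeartbeats 1000000 in
theorem derivations_N621 (h2 : (2 : K) ≠ 0) (α β γ : K) (e : Basis (Fin 6) K N) (he : IsN621 α β γ e) :
    (∀ d : Module.End K N, d ∈ derivations K N ↔
        ∃ d11 d52 d61 d62 d64 d65 : K,
          d (e 0) = d11 • e 0 + d61 • e 5 ∧
          d (e 1) = d11 • e 1 + d11 • e 2 + d52 • e 4 + d62 • e 5 ∧
          d (e 2) = d11 • e 1 + d11 • e 2 - d52 • e 4 - d62 • e 5 ∧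
          d (e 3) = d11 • e 3 + d64 • e 5 ∧
          d (e 4) = (-(γ * d52)) • e 1 - (γ * d52) • e 2 + d11 • e 4 + d65 • e 5 ∧
          d (e 5) = (2 * d11) • e 5) ∧
    Nonempty (derivations K N ≃ₗ[K] (Fin 2 → K) × (Fin 4 → K)) := by
  obtain ⟨hα, hβ, hγ, hn, s0, s1, s2, s3, s4, s5⟩ := he
  obtain ⟨hd, hD⟩ := hn.derivations_of_entries (r := 2) (s := 4)
    ![![0, 1, 1, 0, 0, 0], ![0, 0, 0, 0, 0, 1], ![0, 0, 0, 0, 0, -1], ![0, α, α, 0, 0, β], ![0, 0, 0, 0, 0, γ], 0]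
    (by simp [Fin.forall_fin_succ, Fin.sum_univ_succ, add_assoc, s0, s1, s2, s3, s4, s5])
    (fun x => ![
      ![x 0, 0, 0, 0, 0, x 2],
      ![0, x 0, x 0, 0, x 1, x 3],
      ![0, x 0, x 0, 0, -x 1, -x 3],
      ![0, 0, 0, x 0, 0, x 4],
      ![0, -(γ * x 1), -(γ * x 1), 0, x 0, x 5],
      ![0, 0, 0, 0, 0, 2 * x 0]])
    ![(0, 0), (4, 1), (5, 0), (5, 1), (5, 3), (5, 4)]
    (by simp [Fin.forall_fin_succ]) (fun c => by
      clear s0 s1 s2 s3 s4 s5 hn e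
      simp [Fin.forall_fin_succ, Fin.sum_univ_succ, hα, hβ, hγ]
      constructor <;> intro h <;> grind (splits := 60))
  refine ⟨fun d => (hd d).trans ⟨?_, ?_⟩, hD⟩
  · rintro ⟨x, h⟩
    refine ⟨x 0, x 1, x 2, x 3, x 4, x 5, ?_⟩
    simpa [Fin.forall_fin_succ, Fin.sum_univ_succ, sub_eq_add_neg, add_assoc] using h
  · rintro ⟨d11, d52, d61, d62, d64, d65, h⟩
    refine ⟨![d11, d52, d61, d62, d64, d65], ?_⟩
    simpa [Fin.forall_fin_succ, Fin.sum_univ_succ, sub_eq_add_neg, add_assoc] using h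

set_option maxHeartbeats 1000000 in
-- The squares of `e 0`, `e 3`, `e 4` are proportional, so each pair contributes a mixing parameter:
-- d41, d51, d54.
theorem derivations_N622 (h2 : (2 : K) ≠ 0) (α β : K) (e : Basis (Fin 6) K N) (he : IsN622 α β e) :
    (∀ d : Module.End K N, d ∈ derivations K N ↔
        ∃ d11 d22 d41 d51 d54 d61 d62 d64 d65 : K,
          d (e 0) = d11 • e 0 + d41 • e 3 + d51 • e 4 + d61 • e 5 ∧
          d (e 1) = d22 • e 1 + (2 * d11 - d22) • e 2 + d62 • e 5 ∧
          d (e 2) = (2 * d11 - d22) • e 1 + d22 • e 2 - d62 • e 5 ∧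
          d (e 3) = (-(α * d41)) • e 0 + d11 • e 3 + d54 • e 4 + d64 • e 5 ∧
          d (e 4) = (-(β * d51)) • e 0 - (α⁻¹ * β * d54) • e 3 + d11 • e 4 + d65 • e 5 ∧
          d (e 5) = (2 * d22) • e 5) ∧
    Nonempty (derivations K N ≃ₗ[K] (Fin 5 → K) × (Fin 4 → K)) := by
  obtain ⟨hα, hβ, hn, s0, s1, s2, s3, s4, s5⟩ := he
  obtain ⟨hd, hD⟩ := hn.derivations_of_entries (r := 5) (s := 4)
    ![![0, 1, 1, 0, 0, 0], ![0, 0, 0, 0, 0, 1], ![0, 0, 0, 0, 0, -1], ![0, α, α, 0, 0, 0], ![0, β, β, 0, 0, 0], 0]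
    (by simp [Fin.forall_fin_succ, Fin.sum_univ_succ, s0, s1, s2, s3, s4, s5])
    (fun x => ![
      ![x 0, 0, 0, x 2, x 3, x 5],
      ![0, x 1, 2 * x 0 - x 1, 0, 0, x 6],
      ![0, 2 * x 0 - x 1, x 1, 0, 0, -x 6],
      ![-(α * x 2), 0, 0, x 0, x 4, x 7],
      ![-(β * x 3), 0, 0, -(α⁻¹ * β * x 4), x 0, x 8],
      ![0, 0, 0, 0, 0, 2 * x 1]])
    ![(0, 0), (1, 1), (3, 0), (4, 0), (4, 3), (5, 0), (5, 1), (5, 3), (5, 4)]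
    (by simp [Fin.forall_fin_succ]) (fun c => by
      clear s0 s1 s2 s3 s4 s5 hn e
      simp [Fin.forall_fin_succ, Fin.sum_univ_succ, hα, hβ]
      constructor <;> intro h <;> grind (splits := 60))
  refine ⟨fun d => (hd d).trans ⟨?_, ?_⟩, hD⟩
  · rintro ⟨x, h⟩
    refine ⟨x 0, x 1, x 2, x 3, x 4, x 5, x 6, x 7, x 8, ?_⟩
    simpa [Fin.forall_fin_succ, Fin.sum_univ_succ, sub_eq_add_neg, add_assoc] using h
  · rintro ⟨d11, d22, d41, d51, d54, d61, d62, d64, d65, h⟩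
    refine ⟨![d11, d22, d41, d51, d54, d61, d62, d64, d65], ?_⟩
    simpa [Fin.forall_fin_succ, Fin.sum_univ_succ, sub_eq_add_neg, add_assoc] using h

set_option maxHeartbeats 1000000 in
-- The conditions on the parameters make the squares of `e 0`, `e 1`, `e 3`, `e 4` pairwise
-- independent, so no mixing among these survives; the determinant excludes d54.
theorem derivations_N623 (h2 : (2 : K) ≠ 0) (α β γ δ : K) (e : Basis (Fin 6) K N) (he : IsN623 α β γ δ e) :
    (∀ d : Module.End K N, d ∈ derivations K N ↔
        ∃ d11 d61 d62 d64 d65 : K,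
          d (e 0) = d11 • e 0 + d61 • e 5 ∧
          d (e 1) = d11 • e 1 + d11 • e 2 + d62 • e 5 ∧
          d (e 2) = d11 • e 1 + d11 • e 2 - d62 • e 5 ∧
          d (e 3) = d11 • e 3 + d64 • e 5 ∧
          d (e 4) = d11 • e 4 + d65 • e 5 ∧
          d (e 5) = (2 * d11) • e 5) ∧
    Nonempty (derivations K N ≃ₗ[K] (Fin 1 → K) × (Fin 4 → K)) := by
  obtain ⟨hdet, hαγ, hβδ, hn, s0, s1, s2, s3, s4, s5⟩ := he
  obtain ⟨hα, hγ⟩ := mul_ne_zero_iff.1 hαγ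
  obtain ⟨hβ, hδ⟩ := mul_ne_zero_iff.1 hβδ
  obtain ⟨hd, hD⟩ := hn.derivations_of_entries (r := 1) (s := 4)
    ![![0, 1, 1, 0, 0, 0], ![0, 0, 0, 0, 0, 1], ![0, 0, 0, 0, 0, -1], ![0, α, α, 0, 0, β], ![0, γ, γ, 0, 0, δ], 0]
    (by simp [Fin.forall_fin_succ, Fin.sum_univ_succ, add_assoc, s0, s1, s2, s3, s4, s5])
    (fun x => ![
      ![x 0, 0, 0, 0, 0, x 1],
      ![0, x 0, x 0, 0, 0, x 2],
      ![0, x 0, x 0, 0, 0, -x 2],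
      ![0, 0, 0, x 0, 0, x 3],
      ![0, 0, 0, 0, x 0, x 4],
      ![0, 0, 0, 0, 0, 2 * x 0]])
    ![(0, 0), (5, 0), (5, 1), (5, 3), (5, 4)]
    (by simp [Fin.forall_fin_succ]) (fun c => by
      clear s0 s1 s2 s3 s4 s5 hn e
      simp [Fin.forall_fin_succ, Fin.sum_univ_succ, hα, hβ, hγ, hδ]
      constructor <;> intro h <;> grind (splits := 60))
  refine ⟨fun d => (hd d).trans ⟨?_, ?_⟩, hD⟩
  · rintro ⟨x, h⟩
    refine ⟨x 0, x 1, x 2, x 3, x 4, ?_⟩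
    simpa [Fin.forall_fin_succ, Fin.sum_univ_succ, sub_eq_add_neg, add_assoc] using h
  · rintro ⟨d11, d61, d62, d64, d65, h⟩
    refine ⟨![d11, d61, d62, d64, d65], ?_⟩
    simpa [Fin.forall_fin_succ, Fin.sum_univ_succ, sub_eq_add_neg, add_assoc] using h

set_option maxHeartbeats 1000000 in
-- The proportional squares of `e 0` and `e 4` leave d51 free, while (e 3)² forces d11 = d22.
theorem derivations_N624 (h2 : (2 : K) ≠ 0) (α β γ : K) (e : Basis (Fin 6) K N) (he : IsN624 α β γ e) :
    (∀ d : Module.End K N, d ∈ derivations K N ↔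
        ∃ d11 d51 d61 d62 d64 d65 : K,
          d (e 0) = d11 • e 0 + d51 • e 4 + d61 • e 5 ∧
          d (e 1) = d11 • e 1 + d11 • e 2 + d62 • e 5 ∧
          d (e 2) = d11 • e 1 + d11 • e 2 - d62 • e 5 ∧
          d (e 3) = d11 • e 3 + d64 • e 5 ∧
          d (e 4) = (-(γ * d51)) • e 0 + d11 • e 4 + d65 • e 5 ∧
          d (e 5) = (2 * d11) • e 5) ∧
    Nonempty (derivations K N ≃ₗ[K] (Fin 2 → K) × (Fin 4 → K)) := by
  obtain ⟨hαβγ, hn, s0, s1, s2, s3, s4, s5⟩ := he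
  obtain ⟨hαβ, hγ⟩ := mul_ne_zero_iff.1 hαβγ
  obtain ⟨hα, hβ⟩ := mul_ne_zero_iff.1 hαβ
  obtain ⟨hd, hD⟩ := hn.derivations_of_entries (r := 2) (s := 4)
    ![![0, 1, 1, 0, 0, 0], ![0, 0, 0, 0, 0, 1], ![0, 0, 0, 0, 0, -1], ![0, α, α, 0, 0, β], ![0, γ, γ, 0, 0, 0], 0]
    (by simp [Fin.forall_fin_succ, Fin.sum_univ_succ, add_assoc, s0, s1, s2, s3, s4, s5])
    (fun x => ![
      ![x 0, 0, 0, 0, x 1, x 2],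
      ![0, x 0, x 0, 0, 0, x 3],
      ![0, x 0, x 0, 0, 0, -x 3],
      ![0, 0, 0, x 0, 0, x 4],
      ![-(γ * x 1), 0, 0, 0, x 0, x 5],
      ![0, 0, 0, 0, 0, 2 * x 0]])
    ![(0, 0), (4, 0), (5, 0), (5, 1), (5, 3), (5, 4)]
    (by simp [Fin.forall_fin_succ]) (fun c => by
      clear s0 s1 s2 s3 s4 s5 hn e
      simp [Fin.forall_fin_succ, Fin.sum_univ_succ, hα, hβ, hγ]
      constructor <;> intro h <;> grind (splits := 60))
  refine ⟨fun d => (hd d).trans ⟨?_, ?_⟩, hD⟩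
  · rintro ⟨x, h⟩
    refine ⟨x 0, x 1, x 2, x 3, x 4, x 5, ?_⟩
    simpa [Fin.forall_fin_succ, Fin.sum_univ_succ, sub_eq_add_neg, add_assoc] using h
  · rintro ⟨d11, d51, d61, d62, d64, d65, h⟩
    refine ⟨![d11, d51, d61, d62, d64, d65], ?_⟩
    simpa [Fin.forall_fin_succ, Fin.sum_univ_succ, sub_eq_add_neg, add_assoc] using h

end DerivationTables

end EvoAlg

theorem mainTheorem5 {K : Type*} [Field K] (hK : ringChar K ≠ 2)
    {N : Type*} [NonUnitalNonAssocCommRing N] [Module K N]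
    [IsScalarTower K N N] [SMulCommClass K N N] :
    -- every algebra of the class has a natural basis with one of the listed multiplication tables
    (IsEvolutionAlgebra K N → IsNilAlgebra N → ¬ IsDecomposable K N → IsPowerAssociative N →
      ¬ IsAssociative N → finrank K N ≤ 6 → finrank K (algebraAnnihilator K N) = 1 →
      (∃ e : Basis (Fin 4) K N, IsN46 e) ∨
      (∃ (α : K) (e : Basis (Fin 5) K N), IsN510 α e) ∨
      (∃ (α : K) (e : Basis (Fin 5) K N), IsN511 α e) ∨
      (∃ (α β : K) (e : Basis (Fin 5) K N), IsN512 α β e) ∨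
      (∃ (α β : K) (e : Basis (Fin 6) K N), IsN619 α β e) ∨
      (∃ (α β : K) (e : Basis (Fin 6) K N), IsN620 α β e) ∨
      (∃ (α β γ : K) (e : Basis (Fin 6) K N), IsN621 α β γ e) ∨
      (∃ (α β : K) (e : Basis (Fin 6) K N), IsN622 α β e) ∨
      (∃ (α β γ δ : K) (e : Basis (Fin 6) K N), IsN623 α β γ δ e) ∨
      (∃ (α β γ : K) (e : Basis (Fin 6) K N), IsN624 α β γ e)) ∧
    -- derivations of the algebra N_(4,6)
    (∀ (e : Basis (Fin 4) K N), IsN46 e →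
      (∀ d : Module.End K N, d ∈ derivations K N ↔
        ∃ d11 d22 d41 d42 : K,
          d (e 0) = d11 • e 0 + d41 • e 3 ∧
          d (e 1) = d22 • e 1 + (2 * d11 - d22) • e 2 + d42 • e 3 ∧
          d (e 2) = (2 * d11 - d22) • e 1 + d22 • e 2 - d42 • e 3 ∧
          d (e 3) = (2 * d22) • e 3) ∧
      Nonempty (derivations K N ≃ₗ[K] (Fin 2 → K) × (Fin 2 → K))) ∧
    -- derivations of the algebra N_(5,10)
    (∀ (α : K) (e : Basis (Fin 5) K N), IsN510 α e →
      (∀ d : Module.End K N, d ∈ derivations K N ↔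
        ∃ d11 d22 d42 d51 d52 d54 : K,
          d (e 0) = d11 • e 0 + d51 • e 4 ∧
          d (e 1) = d22 • e 1 + (2 * d11 - d22) • e 2 + d42 • e 3 + d52 • e 4 ∧
          d (e 2) = (2 * d11 - d22) • e 1 + d22 • e 2 - d42 • e 3 - d52 • e 4 ∧
          d (e 3) = (-(α * d42)) • e 1 - (α * d42) • e 2 + d22 • e 3 + d54 • e 4 ∧
          d (e 4) = (2 * d22) • e 4) ∧
      Nonempty (derivations K N ≃ₗ[K] (Fin 3 → K) × (Fin 3 → K))) ∧
    -- derivations of the algebra N_(5,11)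
    (∀ (α : K) (e : Basis (Fin 5) K N), IsN511 α e →
      (∀ d : Module.End K N, d ∈ derivations K N ↔
        ∃ d11 d22 d41 d51 d52 d54 : K,
          d (e 0) = d11 • e 0 + d41 • e 3 + d51 • e 4 ∧
          d (e 1) = d22 • e 1 + (2 * d11 - d22) • e 2 + d52 • e 4 ∧
          d (e 2) = (2 * d11 - d22) • e 1 + d22 • e 2 - d52 • e 4 ∧
          d (e 3) = (-(α * d41)) • e 0 + d11 • e 3 + d54 • e 4 ∧
          d (e 4) = (2 * d22) • e 4) ∧
      Nonempty (derivations K N ≃ₗ[K] (Fin 3 → K) × (Fin 3 → K))) ∧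
    -- derivations of the algebra N_(5,12)
    (∀ (α β : K) (e : Basis (Fin 5) K N), IsN512 α β e →
      (∀ d : Module.End K N, d ∈ derivations K N ↔
        ∃ d11 d51 d52 d54 : K,
          d (e 0) = d11 • e 0 + d51 • e 4 ∧
          d (e 1) = d11 • e 1 + d11 • e 2 + d52 • e 4 ∧
          d (e 2) = d11 • e 1 + d11 • e 2 - d52 • e 4 ∧
          d (e 3) = d11 • e 3 + d54 • e 4 ∧
          d (e 4) = (2 * d11) • e 4) ∧
      Nonempty (derivations K N ≃ₗ[K] (Fin 1 → K) × (Fin 3 → K))) ∧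
    -- derivations of the algebra N_(6,19)
    (∀ (α β : K) (e : Basis (Fin 6) K N), IsN619 α β e →
      (∀ d : Module.End K N, d ∈ derivations K N ↔
        ∃ d11 d22 d42 d52 d54 d61 d62 d64 d65 : K,
          d (e 0) = d11 • e 0 + d61 • e 5 ∧
          d (e 1) = d22 • e 1 + (2 * d11 - d22) • e 2 + d42 • e 3 + d52 • e 4 + d62 • e 5 ∧
          d (e 2) = (2 * d11 - d22) • e 1 + d22 • e 2 - d42 • e 3 - d52 • e 4 - d62 • e 5 ∧
          d (e 3) = (-(α * d42)) • e 1 - (α * d42) • e 2 + d22 • e 3 + d54 • e 4 + d64 • e 5 ∧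
          d (e 4) = (-(β * d52)) • e 1 - (β * d52) • e 2 - (α⁻¹ * β * d54) • e 3 + d22 • e 4 + d65 • e 5 ∧
          d (e 5) = (2 * d22) • e 5) ∧
      Nonempty (derivations K N ≃ₗ[K] (Fin 5 → K) × (Fin 4 → K))) ∧
    -- derivations of the algebra N_(6,20)
    (∀ (α β : K) (e : Basis (Fin 6) K N), IsN620 α β e →
      (∀ d : Module.End K N, d ∈ derivations K N ↔
        ∃ d11 d22 d41 d52 d61 d62 d64 d65 : K,
          d (e 0) = d11 • e 0 + d41 • e 3 + d61 • e 5 ∧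
          d (e 1) = d22 • e 1 + (2 * d11 - d22) • e 2 + d52 • e 4 + d62 • e 5 ∧
          d (e 2) = (2 * d11 - d22) • e 1 + d22 • e 2 - d52 • e 4 - d62 • e 5 ∧
          d (e 3) = (-(α * d41)) • e 0 + d11 • e 3 + d64 • e 5 ∧
          d (e 4) = (-(β * d52)) • e 1 - (β * d52) • e 2 + d22 • e 4 + d65 • e 5 ∧
          d (e 5) = (2 * d22) • e 5) ∧
      Nonempty (derivations K N ≃ₗ[K] (Fin 4 → K) × (Fin 4 → K))) ∧
    -- derivations of the algebra N_(6,21)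
    (∀ (α β γ : K) (e : Basis (Fin 6) K N), IsN621 α β γ e →
      (∀ d : Module.End K N, d ∈ derivations K N ↔
        ∃ d11 d52 d61 d62 d64 d65 : K,
          d (e 0) = d11 • e 0 + d61 • e 5 ∧
          d (e 1) = d11 • e 1 + d11 • e 2 + d52 • e 4 + d62 • e 5 ∧
          d (e 2) = d11 • e 1 + d11 • e 2 - d52 • e 4 - d62 • e 5 ∧
          d (e 3) = d11 • e 3 + d64 • e 5 ∧
          d (e 4) = (-(γ * d52)) • e 1 - (γ * d52) • e 2 + d11 • e 4 + d65 • e 5 ∧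
          d (e 5) = (2 * d11) • e 5) ∧
      Nonempty (derivations K N ≃ₗ[K] (Fin 2 → K) × (Fin 4 → K))) ∧
    -- derivations of the algebra N_(6,22)
    (∀ (α β : K) (e : Basis (Fin 6) K N), IsN622 α β e →
      (∀ d : Module.End K N, d ∈ derivations K N ↔
        ∃ d11 d22 d41 d51 d54 d61 d62 d64 d65 : K,
          d (e 0) = d11 • e 0 + d41 • e 3 + d51 • e 4 + d61 • e 5 ∧
          d (e 1) = d22 • e 1 + (2 * d11 - d22) • e 2 + d62 • e 5 ∧
          d (e 2) = (2 * d11 - d22) • e 1 + d22 • e 2 - d62 • e 5 ∧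
          d (e 3) = (-(α * d41)) • e 0 + d11 • e 3 + d54 • e 4 + d64 • e 5 ∧
          d (e 4) = (-(β * d51)) • e 0 - (α⁻¹ * β * d54) • e 3 + d11 • e 4 + d65 • e 5 ∧
          d (e 5) = (2 * d22) • e 5) ∧
      Nonempty (derivations K N ≃ₗ[K] (Fin 5 → K) × (Fin 4 → K))) ∧
    -- derivations of the algebra N_(6,23)
    (∀ (α β γ δ : K) (e : Basis (Fin 6) K N), IsN623 α β γ δ e →
      (∀ d : Module.End K N, d ∈ derivations K N ↔
        ∃ d11 d61 d62 d64 d65 : K,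
          d (e 0) = d11 • e 0 + d61 • e 5 ∧
          d (e 1) = d11 • e 1 + d11 • e 2 + d62 • e 5 ∧
          d (e 2) = d11 • e 1 + d11 • e 2 - d62 • e 5 ∧
          d (e 3) = d11 • e 3 + d64 • e 5 ∧
          d (e 4) = d11 • e 4 + d65 • e 5 ∧
          d (e 5) = (2 * d11) • e 5) ∧
      Nonempty (derivations K N ≃ₗ[K] (Fin 1 → K) × (Fin 4 → K))) ∧
    -- derivations of the algebra N_(6,24)
    (∀ (α β γ : K) (e : Basis (Fin 6) K N), IsN624 α β γ e →
      (∀ d : Module.End K N, d ∈ derivations K N ↔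
        ∃ d11 d51 d61 d62 d64 d65 : K,
          d (e 0) = d11 • e 0 + d51 • e 4 + d61 • e 5 ∧
          d (e 1) = d11 • e 1 + d11 • e 2 + d62 • e 5 ∧
          d (e 2) = d11 • e 1 + d11 • e 2 - d62 • e 5 ∧
          d (e 3) = d11 • e 3 + d64 • e 5 ∧
          d (e 4) = (-(γ * d51)) • e 0 + d11 • e 4 + d65 • e 5 ∧
          d (e 5) = (2 * d11) • e 5) ∧
      Nonempty (derivations K N ≃ₗ[K] (Fin 2 → K) × (Fin 4 → K))) := by
  have h2 : (2 : K) ≠ 0 := Ring.two_ne_zero hK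
  refine ⟨?_, derivations_N46, derivations_N510 h2, derivations_N511 h2, derivations_N512 h2,
    derivations_N619 h2, derivations_N620 h2, derivations_N621 h2, derivations_N622 h2,
    derivations_N623 h2, derivations_N624 h2⟩
  rintro ⟨n, e, he⟩ hnil - hpa hna hdim hann
  exact classification h2 he hnil hpa hna hann hdim
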